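/- Let $F_n$ be the free group of rank $n$ and let $\mathcal{OF}_n$ be the geometric realisation of the poset of conjugacy classes $[A]$ of non-trivial proper free factors $A<F_n$, where $[A]\le [B]$ if some conjugate of $A$ is contained in $B$; the rank of the vertex $[A]$ is the rank of $A$. Let $\mathcal{AF}_n$ be the geometric realisation of the poset of non-trivial proper free factors of $F_n$, ordered by inclusion. The barycentric subdivision of the boundary $\partial\Delta_{n-1}$ of the $(n-1)$-simplex is identified with the geometric realisation of the poset of non-empty proper subsets $S$ of its vertex set $\{0,\dots,n-1\}$; a face $T$ has barycentre $T$, and the face opposite $i$ is $\{0,\dots,n-1\}\smallsetminus\{i\}$. An apartment $\Delta$ in $\mathcal{OF}_n$ is the image of a simplicial embedding $\sigma$ of this barycentric subdivision into $\mathcal{OF}_n$ such that $\mathrm{rank}(\sigma(S))=|S|$ for all $S$. The rank $k$ faces of $\Delta$ are the images of the (subdivided) faces $T$ of $\partial\Delta_{n-1}$ with $|T|=k$. A standard apartment in $\mathcal{AF}_n$ is the full subcomplex spanned by the free factors generated by the non-empty proper subsets of a basis of $F_n$, and its rank $k$ faces are the full subcomplexes spanned by the free factors generated by the non-empty subsets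 of a fixed $k$-element subset of the basis. An apartment in $\mathcal{OF}_n$, or a face of one, is standard if it is the image under $\mathcal{AF}_n\to\mathcal{OF}_n$ of a standard apartment, respectively of a face of a standard apartment. A vertex $[\Lambda]$ of rank $n-1$ and a vertex $[u]$ of rank $1$ in $\mathcal{OF}_n$ are antipodal if they have representatives $\Lambda_0\in[\Lambda]$ and $C\in[u]$ with $\Lambda_0*C=F_n$. Lemma. Let $n\ge 3$. An apartment $\Delta$ in $\mathcal{OF}_n$ is standard if and only if it satisfies the following conditions: (1) each rank $n-1$ face of $\Delta$ is standard; (2) every rank $1$ vertex of $\Delta$ is antipodal to the barycentre of the opposite face; (3) for each rank $n-1$ vertex $V$ of $\Delta$ there is a rank $1$ vertex of $\mathcal{OF}_n$, adjacent to $V$, that is antipodal to every rank $n-1$ vertex of $\Delta$ other than $V$. -/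

import Mathlib

namespace FreeFactors

/-! ### Free factors -/

/-- `G = A * B`: the group `G` is the internal free product of its subgroups `A` and `B`. -/
def IsFreeProduct {G : Type*} [Group G] (A B : Subgroup G) : Prop :=
  Function.Bijective (Monoid.Coprod.lift A.subtype B.subtype)

/-- `A` is a free factor of `G`. -/
def IsFreeFactor {G : Type*} [Group G] (A : Subgroup G) : Prop :=
  ∃ B : Subgroup G, IsFreeProduct A B

/-- The image of a subgroup under conjugation by `g`, namely `g A g⁻¹`. -/
def conjBy {G : Type*} [Group G] (g : G) (A : Subgroup G) : Subgroup G :=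
  A.map (MulAut.conj g).toMonoidHom

theorem mem_conjBy {G : Type*} [Group G] {g x : G} {A : Subgroup G} :
    x ∈ conjBy g A ↔ g⁻¹ * x * g ∈ A := by
  unfold conjBy
  constructor
  · rintro ⟨a, ha, rfl⟩
    simpa [mul_assoc] using ha
  · intro h
    exact ⟨_, h, by simp [mul_assoc]⟩

theorem conjBy_one {G : Type*} [Group G] (A : Subgroup G) : conjBy 1 A = A := by
  ext x; simp [mem_conjBy]

theorem conjBy_conjBy {G : Type*} [Group G] (g h : G) (A : Subgroup G) :
    conjBy g (conjBy h A) = conjBy (g * h) A := by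
  ext x; simp [mem_conjBy, mul_assoc]

theorem conjBy_mono {G : Type*} [Group G] (g : G) {A B : Subgroup G} (h : A ≤ B) :
    conjBy g A ≤ conjBy g B := Subgroup.map_mono h

theorem IsFreeProduct.conjBy {G : Type*} [Group G] {A B : Subgroup G}
    (h : IsFreeProduct A B) (g : G) :
    IsFreeProduct (FreeFactors.conjBy g A) (FreeFactors.conjBy g B) := by
  let e : G ≃* G := MulAut.conj g
  let eA := e.subgroupMap A
  let eB := e.subgroupMap B
  have key : (Monoid.Coprod.lift (FreeFactors.conjBy g A).subtype
      (FreeFactors.conjBy g B).subtype).comp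
        (MulEquiv.coprodCongr eA eB).toMonoidHom =
      e.toMonoidHom.comp (Monoid.Coprod.lift A.subtype B.subtype) := by
    ext x <;> rfl
  have hb : Function.Bijective ((Monoid.Coprod.lift (FreeFactors.conjBy g A).subtype
      (FreeFactors.conjBy g B).subtype).comp (MulEquiv.coprodCongr eA eB).toMonoidHom) := by
    rw [key]
    exact e.bijective.comp h
  exact (Function.Bijective.of_comp_iff _ (MulEquiv.coprodCongr eA eB).bijective).1 hb

theorem IsFreeFactor.conjBy {G : Type*} [Group G] {A : Subgroup G}
    (h : IsFreeFactor A) (g : G) : IsFreeFactor (FreeFactors.conjBy g A) :=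
  let ⟨B, hB⟩ := h
  ⟨FreeFactors.conjBy g B, hB.conjBy g⟩

/-- A free factor is a retract. -/
theorem IsFreeFactor.exists_retraction {G : Type*} [Group G] {A : Subgroup G}
    (h : IsFreeFactor A) : ∃ r : G →* A, ∀ a : A, r a = a := by
  obtain ⟨B, hB⟩ := h
  let e := MulEquiv.ofBijective _ hB
  refine ⟨(Monoid.Coprod.lift (MonoidHom.id A) (1 : B →* A)).comp e.symm.toMonoidHom, ?_⟩
  intro a
  have : e.symm (a : G) = Monoid.Coprod.inl a := by
    rw [MulEquiv.symm_apply_eq]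
    exact (Monoid.Coprod.lift_apply_inl A.subtype B.subtype a).symm
  simp [this]

/-- A free factor that is contained in one of its conjugates is equal to it. -/
theorem IsFreeFactor.eq_of_le_conjBy {G : Type*} [Group G] {A : Subgroup G}
    (h : IsFreeFactor A) (g : G) (hle : A ≤ FreeFactors.conjBy g A) :
    FreeFactors.conjBy g A ≤ A := by
  obtain ⟨r, hr⟩ := h.exists_retraction
  intro x hx
  rw [mem_conjBy] at hx
  -- `a = g⁻¹ x g ∈ A`; the element `y = r(g) a r(g)⁻¹` of `A` satisfies `g⁻¹ y g = a`.
  let a : A := ⟨_, hx⟩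
  let y : A := r g * a * (r g)⁻¹
  have hy : g⁻¹ * (y : G) * g ∈ A := mem_conjBy.1 (hle y.2)
  have h1 : r (g⁻¹ * (y : G) * g) = a := by
    simp [hr, y, mul_assoc]
  have h2 : r (g⁻¹ * (y : G) * g) = ⟨_, hy⟩ := hr ⟨_, hy⟩
  have h3 : g⁻¹ * (y : G) * g = g⁻¹ * x * g := congrArg Subtype.val (h2.symm.trans h1)
  have h4 : (y : G) = x := by simpa using h3
  exact h4 ▸ y.2

/-! ### The posets of free factors and of their conjugacy classes -/

/-- Vertices of `AF_n`: the non-trivial proper free factors of the free group of rank `n`,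
partially ordered by inclusion. -/
abbrev AF (n : ℕ) : Type :=
  {A : Subgroup (FreeGroup (Fin n)) // IsFreeFactor A ∧ A ≠ ⊥ ∧ A ≠ ⊤}

/-- Conjugate of a vertex of `AF_n`. -/
def AF.conj {n : ℕ} (g : FreeGroup (Fin n)) (A : AF n) : AF n :=
  ⟨conjBy g A.1, A.2.1.conjBy g,
    fun h => A.2.2.1 (by
      have := congrArg (conjBy g⁻¹) h
      rw [conjBy_conjBy, inv_mul_cancel, conjBy_one] at this
      rw [this]; simp [conjBy]),
    fun h => A.2.2.2 (by
      have := congrArg (conjBy g⁻¹) h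
      rw [conjBy_conjBy, inv_mul_cancel, conjBy_one] at this
      rw [this]
      ext x; simp [mem_conjBy])⟩

/-- Conjugacy of free factors. -/
def conjSetoid (n : ℕ) : Setoid (AF n) where
  r A B := ∃ g : FreeGroup (Fin n), B = A.conj g
  iseqv :=
    { refl := fun A => ⟨1, Subtype.ext (conjBy_one A.1).symm⟩
      symm := by
        rintro A _ ⟨g, rfl⟩
        refine ⟨g⁻¹, Subtype.ext ?_⟩
        simp [AF.conj, conjBy_conjBy, conjBy_one]
      trans := by
        rintro A _ _ ⟨g, rfl⟩ ⟨h, rfl⟩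
        exact ⟨h * g, Subtype.ext (conjBy_conjBy h g A.1)⟩ }

/-- Vertices of `OF_n`: the conjugacy classes of non-trivial proper free factors. -/
def OF (n : ℕ) : Type := Quotient (conjSetoid n)

/-- The conjugacy class of a free factor; on vertices, the map `AF_n → OF_n`. -/
def cls {n : ℕ} (A : AF n) : OF n := Quotient.mk (conjSetoid n) A

theorem cls_eq_iff {n : ℕ} {A B : AF n} :
    cls A = cls B ↔ ∃ g : FreeGroup (Fin n), B = A.conj g :=
  Quotient.eq (r := conjSetoid n)

/-- `x ≤ y` if some representative of `x` is contained in some representative of `y`. -/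
instance (n : ℕ) : PartialOrder (OF n) where
  le x y := ∃ A B : AF n, cls A = x ∧ cls B = y ∧ A ≤ B
  le_refl x := by
    obtain ⟨A, rfl⟩ := Quotient.exists_rep x
    exact ⟨A, A, rfl, rfl, le_rfl⟩
  le_trans := by
    rintro _ _ _ ⟨A, B, rfl, rfl, hAB⟩ ⟨B', C, hB, rfl, hBC⟩
    obtain ⟨g, rfl⟩ := cls_eq_iff.1 hB
    have h : conjBy g B'.1 ≤ conjBy g C.1 := conjBy_mono g hBC
    exact ⟨A, C.conj g, rfl, (cls_eq_iff.2 ⟨g, rfl⟩).symm, hAB.trans h⟩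
  le_antisymm := by
    rintro _ _ ⟨A, B, rfl, rfl, hAB⟩ ⟨B', A', hB, hA, hBA⟩
    obtain ⟨g, rfl⟩ := cls_eq_iff.1 hB
    obtain ⟨h, rfl⟩ := cls_eq_iff.1 hA.symm
    have hAB' : A.1 ≤ conjBy g B'.1 := hAB
    have hBA' : conjBy g B'.1 ≤ conjBy (g * h) A.1 := by
      rw [← conjBy_conjBy]; exact conjBy_mono g hBA
    have h3 := A.2.1.eq_of_le_conjBy (g * h) (hAB'.trans hBA')
    exact congrArg cls (Subtype.ext (le_antisymm hAB' (hBA'.trans h3)))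

/-- The vertex `v` of `OF_n` has rank `k`: it is the class of a free group of rank `k`. -/
def HasRank {n : ℕ} (v : OF n) (k : ℕ) : Prop :=
  ∃ A : AF n, cls A = v ∧ Nonempty (FreeGroupBasis (Fin k) A.1)

/-! ### Simplicial complexes -/

/-- The order complex of a poset `P`, whose geometric realisation is that of `P`:
its simplices are the non-empty finite chains of `P`. -/
def orderComplex (P : Type*) [PartialOrder P] : PreAbstractSimplicialComplex P where
  faces := {s | s.Nonempty ∧ IsChain (· ≤ ·) (s : Set P)}
  isRelLowerSet_faces := fun _ hs =>
    ⟨hs.1, fun _ hts ht => ⟨ht, hs.2.mono (Finset.coe_subset.2 hts)⟩⟩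

/-- The full subcomplex of `K` spanned by a set `X` of vertices. -/
def fullSubcomplex {V : Type*} (K : PreAbstractSimplicialComplex V) (X : Set V) :
    PreAbstractSimplicialComplex V where
  faces := {s | s ∈ K.faces ∧ (s : Set V) ⊆ X}
  isRelLowerSet_faces := fun _ hs =>
    ⟨(K.isRelLowerSet_faces hs.1).1, fun _ hts ht =>
      ⟨(K.isRelLowerSet_faces hs.1).2 hts ht, (Finset.coe_subset.2 hts).trans hs.2⟩⟩

open Classical in
/-- The image of a simplicial complex under a map of vertices. -/
noncomputable def imageComplex {V W : Type*} (f : V → W) (K : PreAbstractSimplicialComplex V) :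
    PreAbstractSimplicialComplex W :=
  K.map f

/-- The non-empty proper subsets of `{0, …, n - 1}`, ordered by inclusion. The order complex of this
poset is the barycentric subdivision of the boundary of the `(n - 1)`-simplex. -/
abbrev BdryVertex (n : ℕ) : Type :=
  {S : Finset (Fin n) // S.Nonempty ∧ S ≠ Finset.univ}

/-- The vertex `i` of the boundary of the `(n - 1)`-simplex. -/
def vertex {n : ℕ} (hn : 3 ≤ n) (i : Fin n) : BdryVertex n :=
  ⟨{i}, Finset.singleton_nonempty i, fun h => by
    have := congrArg Finset.card h
    simp at this
    omega⟩

/-- The barycentre `{0, …, n - 1} ∖ {i}` of the face opposite the vertex `i`. -/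
def oppBarycentre {n : ℕ} (hn : 3 ≤ n) (i : Fin n) : BdryVertex n :=
  ⟨{i}ᶜ, by
    rw [← Finset.card_pos, Finset.card_compl]
    simp
    omega, fun h => by
    have := h ▸ Finset.mem_univ i
    simp at this⟩

/-! ### Apartments in `OF_n` -/

/-- `σ` is (the map of vertices of) a simplicial embedding of the barycentric subdivision of the
boundary of the `(n - 1)`-simplex in `OF_n` such that `σ S` has rank `|S|` for all `S`. The apartments
are the images of these maps. -/
structure IsApartmentMap {n : ℕ} (σ : BdryVertex n → OF n) : Prop where
  injective : Function.Injective σ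
  simplicial : imageComplex σ (orderComplex (BdryVertex n)) ≤ orderComplex (OF n)
  rank : ∀ S : BdryVertex n, HasRank (σ S) S.1.card

/-- The apartment which is the image of `σ`. -/
noncomputable def apartment {n : ℕ} (σ : BdryVertex n → OF n) : PreAbstractSimplicialComplex (OF n) :=
  imageComplex σ (orderComplex (BdryVertex n))

/-- The face `T` of the apartment which is the image of `σ`: the image of the barycentric subdivision
of the simplex with vertex set `T`. -/
noncomputable def face {n : ℕ} (σ : BdryVertex n → OF n) (T : BdryVertex n) :
    PreAbstractSimplicialComplex (OF n) :=
  imageComplex σ (fullSubcomplex (orderComplex (BdryVertex n)) {S | S ≤ T})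

/-- The standard apartment of a basis in `AF_n`: the full subcomplex spanned by the free factors
generated by the non-empty proper subsets of the basis. -/
def standardAF {n : ℕ} (b : FreeGroupBasis (Fin n) (FreeGroup (Fin n))) :
    PreAbstractSimplicialComplex (AF n) :=
  fullSubcomplex (orderComplex (AF n))
    {A | ∃ S : BdryVertex n, A.1 = Subgroup.closure (b '' (S.1 : Set (Fin n)))}

/-- The face `T` of the standard apartment of a basis in `AF_n`. -/
def standardFaceAF {n : ℕ} (b : FreeGroupBasis (Fin n) (FreeGroup (Fin n))) (T : BdryVertex n) :
    PreAbstractSimplicialComplex (AF n) :=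
  fullSubcomplex (orderComplex (AF n))
    {A | ∃ S : BdryVertex n, S ≤ T ∧ A.1 = Subgroup.closure (b '' (S.1 : Set (Fin n)))}

/-- A subcomplex of `OF_n` is a standard apartment if it is the image of one in `AF_n`. -/
def IsStandard {n : ℕ} (K : PreAbstractSimplicialComplex (OF n)) : Prop :=
  ∃ b : FreeGroupBasis (Fin n) (FreeGroup (Fin n)), K = imageComplex cls (standardAF b)

/-- A subcomplex of `OF_n` is a standard rank-`k` face if it is the image of a rank-`k` face
(a face whose barycentre has rank `k`) of a standard apartment in `AF_n`. -/
def IsStandardFace {n : ℕ} (k : ℕ) (K : PreAbstractSimplicialComplex (OF n)) : Prop :=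
  ∃ (b : FreeGroupBasis (Fin n) (FreeGroup (Fin n))) (T : BdryVertex n),
    T.1.card = k ∧ K = imageComplex cls (standardFaceAF b T)

/-- Antipodality of a vertex `v` of rank `n - 1` and a vertex `u` of rank `1`: they have
representatives `A` and `C` with `A * C = F_n`. -/
def Antipodal {n : ℕ} (v u : OF n) : Prop :=
  ∃ A C : AF n, cls A = v ∧ cls C = u ∧ IsFreeProduct A.1 C.1

/-- Two vertices of `OF_n` are joined by an edge. -/
def Adjacent {n : ℕ} (u v : OF n) : Prop :=
  u ≠ v ∧ (u ≤ v ∨ v ≤ u)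

end FreeFactors

open FreeFactors

namespace FreeGroup

/-! ### Words in free groups -/

/-! For a standard apartment with basis `c`, the class of `c j` is antipodal to that of the span of
the other members. For condition (3) at the face opposite `i`, take a product of all `c j` with `j ≠
i`: each of these `c j` can be exchanged for it.

Conversely, standardness of the faces gives a basis of the whole group for each face, but its member
indexed by the opposite vertex is unrelated to the apartment. By condition (2) that member can be
replaced by a conjugate of a generator of the opposite vertex (`IsBasis.exists_isConj`), so the
bases `b m` have conjugate members, and their partial spans agree up to conjugacy on common faces.
It remains to conjugate them so that they are parts of one basis (`exists_glue`).

Two algebraic facts carry the gluing. First, an element that generates the group together with all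
basis elements but `c i` has the form `γ (c i)^{±1} δ` with `γ`, `δ` in the span of the others
(`eq_mul_of_mul_of_closure_eq_top`, a ping-pong argument on reduced words). Second, if `g⁻¹ (c
i)^{±1} g v`, with `v ≠ 1` in that span, is conjugate to an element of this form, then `g` lies in
the span up to a power of `c i` on the left (`exists_zpow_mul_mem_of_isConj`, a count of letters).
With the element `u` of condition (3), they show that two face bases, once conjugated to agree on
their common face, merge into one basis (`IsBasis.merge`).

What is left is the choice of conjugators. Members of a basis have cyclic centralisers, so the
conjugators are determined up to powers of basis elements. For `n ≥ 4` exponent sums force these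
powers to be trivial; for `n = 3` the common faces are single vertices, and a third merge shows that
the discrepancy is a product of two powers, which can be absorbed. -/

theorem _root_.List.exists_eq_append_head {α : Type*} (q : α → Prop) (L : List α) :
    ∃ L₁ L₂, L = L₁ ++ L₂ ∧ (∀ a ∈ L₁, q a) ∧ ∀ a ∈ L₂.head?, ¬ q a := by
  classical
  induction L with
  | nil => exact ⟨[], [], by simp⟩
  | cons x L ih =>
    obtain ⟨L₁, L₂, rfl, h₁, h₂⟩ := ih
    by_cases hx : q x
    · exact ⟨x :: L₁, L₂, by simp, by simpa [hx] using h₁, h₂⟩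
    · exact ⟨[], x :: (L₁ ++ L₂), by simp, by simp, by simpa using hx⟩

theorem _root_.List.exists_eq_append_getLast {α : Type*} (q : α → Prop) (L : List α) :
    ∃ L₁ L₂, L = L₁ ++ L₂ ∧ (∀ a ∈ L₂, q a) ∧ ∀ a ∈ L₁.getLast?, ¬ q a := by
  obtain ⟨L₁, L₂, h, h₁, h₂⟩ := List.exists_eq_append_head q L.reverse
  refine ⟨L₂.reverse, L₁.reverse, ?_, by simpa using h₁, by simpa using h₂⟩
  rw [← List.reverse_append, ← h, List.reverse_reverse]

variable {ι : Type*}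

theorem head?_invRev (L : List (ι × Bool)) :
    (invRev L).head? = L.getLast?.map fun p => (p.1, !p.2) := by
  simp [invRev]

theorem getLast?_invRev (L : List (ι × Bool)) :
    (invRev L).getLast? = L.head?.map fun p => (p.1, !p.2) := by
  simp [invRev]

theorem mem_invRev {L : List (ι × Bool)} {p : ι × Bool} :
    p ∈ invRev L ↔ (p.1, !p.2) ∈ L := by
  obtain ⟨a, b⟩ := p
  cases b <;> simp [invRev]

theorem mk_mem_closure {S : Set ι} {L : List (ι × Bool)} (h : ∀ p ∈ L, p.1 ∈ S) :
    mk L ∈ Subgroup.closure (of '' S) := by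
  induction L with
  | nil => exact one_mem _
  | cons x L ih =>
    obtain ⟨a, b⟩ := x
    have hx : mk [(a, b)] ∈ Subgroup.closure (of '' S) := by
      have ha : of a ∈ Subgroup.closure (of '' S) :=
        Subgroup.subset_closure ⟨a, h (a, b) (by simp), rfl⟩
      cases b with
      | true => exact ha
      | false => simpa [of, invRev] using inv_mem ha
    have := mul_mem hx (ih fun p hp => h p (by simp [hp]))
    rwa [mul_mk] at this

theorem mk_singleton_eq (i : ι) (e : Bool) :
    mk [(i, e)] = of i ∨ mk [(i, e)] = (of i)⁻¹ := by
  cases e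
  · right; simp [of, invRev]
  · left; rfl

/-! ### Reduced words with one distinguished letter -/

section
variable [DecidableEq ι]

theorem IsReduced.toWord_mk {L : List (ι × Bool)} (h : IsReduced L) : (mk L).toWord = L := by
  rw [FreeGroup.toWord_mk, h.reduce_eq]

theorem IsReduced.invRev {L : List (ι × Bool)} (h : IsReduced L) : IsReduced (invRev L) := by
  rw [isReduced_iff_reduce_eq, reduce_invRev, h.reduce_eq]

theorem IsCyclicallyReduced.invRev {L : List (ι × Bool)} (h : IsCyclicallyReduced L) :
    IsCyclicallyReduced (invRev L) := by
  refine ⟨h.1.invRev, ?_⟩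
  intro a ha b hb hab
  rw [getLast?_invRev, Option.mem_def, Option.map_eq_some_iff] at ha
  rw [head?_invRev, Option.mem_def, Option.map_eq_some_iff] at hb
  obtain ⟨a, ha, rfl⟩ := ha
  obtain ⟨b, hb, rfl⟩ := hb
  simpa using (h.2 b hb a ha hab.symm).symm

/-- The reduced word of a product is a sublist of the concatenation of the factors' words, so
multiplication creates no new letters. -/
theorem mem_closure_of_iff {S : Set ι} {x : FreeGroup ι} :
    x ∈ Subgroup.closure (of '' S) ↔ ∀ p ∈ x.toWord, p.1 ∈ S := by
  constructor
  · intro hx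
    induction hx using Subgroup.closure_induction with
    | mem x hx => obtain ⟨a, ha, rfl⟩ := hx; simpa using ha
    | one => simp
    | mul x y _ _ hx hy =>
      intro p hp
      rcases List.mem_append.1 ((toWord_mul_sublist x y).subset hp) with h | h
      exacts [hx p h, hy p h]
    | inv x _ hx =>
      intro p hp
      rw [toWord_inv, mem_invRev] at hp
      exact hx (p.1, !p.2) hp
  · intro h
    rw [← mk_toWord (x := x)]
    exact mk_mem_closure h

theorem of_notMem_closure_compl (i : ι) :
    of i ∉ Subgroup.closure ((of : ι → FreeGroup ι) '' {i}ᶜ) := by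
  intro h
  simpa using mem_closure_of_iff.1 h (i, true) (by simp)

/-- Left multiplication by `w = p c p⁻¹`, with `c` cyclically reduced, maps reduced words that do
not begin with `p c⁻¹` to reduced words that begin with `p c`. -/
theorem exists_toWord_conj_mul_eq {i : ι} {p c Y : List (ι × Bool)} (hc : IsCyclicallyReduced c)
    (hne : c ≠ []) (hM : IsReduced (p ++ c ++ invRev p))
    (hlast : ∀ a ∈ (p ++ c ++ invRev p).getLast?, a.1 = i) (hY : IsReduced Y)
    (h : (∀ a ∈ Y.head?, a.1 ≠ i) ∨ ∃ Y', Y = p ++ c ++ Y') :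
    ∃ Y', (mk (p ++ c ++ invRev p) * mk Y).toWord = p ++ c ++ Y' := by
  rcases h with h | ⟨Y', rfl⟩
  · refine ⟨invRev p ++ Y, ?_⟩
    rw [mul_mk, IsReduced.toWord_mk, List.append_assoc]
    rw [IsReduced, List.isChain_append]
    exact ⟨hM, hY, fun a ha b hb hab => absurd (hab.symm.trans (hlast a ha)) (h b hb)⟩
  · refine ⟨c ++ Y', ?_⟩
    -- Only `p⁻¹ p` cancels. The remaining `p c c Y'` is reduced because `c`, being cyclically
    -- reduced, can be repeated.
    have : mk (p ++ c ++ invRev p) * mk (p ++ c ++ Y') = mk (p ++ c ++ (c ++ Y')) := by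
      simp only [← mul_mk, ← inv_mk]; group
    rw [this, IsReduced.toWord_mk]
    have hcc : IsReduced (c ++ c) := by
      have := (hc.flatten_replicate 2).isReduced
      simpa [List.replicate] using this
    have hcY : IsReduced (c ++ Y') := hY.infix ⟨p, [], by simp⟩
    have hpc : IsReduced (p ++ c) := hM.infix ⟨[], invRev p, by simp⟩
    rw [← List.append_assoc]
    refine IsReduced.append_overlap ?_ hcY hne
    exact IsReduced.append_overlap hpc hcc hne

/-- If `s` generates the free group together with all basis elements except `of i`, then
`s = γ (of i)^{±1} δ` with `γ`, `δ` in the span of these basis elements. -/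
theorem eq_mul_of_mul_of_closure_eq_top {i : ι} {s : FreeGroup ι}
    (h : Subgroup.closure (insert s ((of : ι → FreeGroup ι) '' {i}ᶜ)) = ⊤) :
    ∃ γ ∈ Subgroup.closure ((of : ι → FreeGroup ι) '' {i}ᶜ),
      ∃ δ ∈ Subgroup.closure ((of : ι → FreeGroup ι) '' {i}ᶜ),
        ∃ t, (t = of i ∨ t = (of i)⁻¹) ∧ s = γ * t * δ := by
  set B := Subgroup.closure ((of : ι → FreeGroup ι) '' {i}ᶜ) with hB
  obtain ⟨L₁, L', hL, hL₁, hL'⟩ := List.exists_eq_append_head (fun a => a.1 ≠ i) s.toWord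
  obtain ⟨M, L₂, rfl, hL₂, hM₂⟩ := List.exists_eq_append_getLast (fun a => a.1 ≠ i) L'
  have hs : s = mk L₁ * mk M * mk L₂ := by
    rw [mul_mk, mul_mk, List.append_assoc, ← hL, mk_toWord]
  have hγ : mk L₁ ∈ B := mk_mem_closure hL₁
  have hδ : mk L₂ ∈ B := mk_mem_closure hL₂
  have hMred : IsReduced M := (isReduced_toWord (x := s)).infix ⟨L₁, L₂, by simp [hL]⟩
  have hMne : M ≠ [] := by
    rintro rfl
    refine of_notMem_closure_compl i ?_
    have : Subgroup.closure (insert s ((of : ι → FreeGroup ι) '' {i}ᶜ)) ≤ B := by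
      rw [Subgroup.closure_le, Set.insert_subset_iff]
      refine ⟨?_, Subgroup.subset_closure⟩
      rw [hs]
      exact mul_mem (mul_mem hγ (one_mem _)) hδ
    exact this (h ▸ Subgroup.mem_top _)
  have hM₁ : ∀ a ∈ M.head?, a.1 = i := by
    intro a ha
    have := hL' a (by simp_all [List.head?_append])
    simpa using this
  have hM₂ : ∀ a ∈ M.getLast?, a.1 = i := fun a ha => by simpa using hM₂ a ha
  set p := reduceCyclically.conjugator M
  set c := reduceCyclically M
  have hpc : p ++ c ++ invRev p = M := reduceCyclically.conj_conjugator_reduceCyclically M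
  have hc : IsCyclicallyReduced c := reduceCyclically.isCyclicallyReduced hMred
  have hcne : c ≠ [] := by
    intro hc0
    have h1 : (mk M).toWord = M := hMred.toWord_mk
    have h2 : mk M = 1 := by
      rw [← hpc, hc0, List.append_nil, ← mul_mk, ← inv_mk, mul_inv_cancel]
    rw [h2, toWord_one] at h1
    exact hMne h1.symm
  have hinv : invRev M = p ++ invRev c ++ invRev p := by
    rw [← hpc]; simp [invRev_append, invRev_invRev, List.append_assoc]
  have hc'ne : invRev c ≠ [] := fun h0 => hcne (by
    rw [← invRev_invRev (L₁ := c), h0, invRev_empty])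
  have hpos : ∀ a ∈ (p ++ c).head?, a.1 = i := by
    intro a ha
    apply hM₁
    rw [← hpc, List.head?_append, Option.mem_def.1 ha]
    rfl
  have hneg : ∀ a ∈ (p ++ invRev c).head?, a.1 = i := by
    intro a ha
    have h1 : (invRev M).head? = some a := by
      rw [hinv, List.head?_append, Option.mem_def.1 ha]
      rfl
    rw [head?_invRev, Option.map_eq_some_iff] at h1
    obtain ⟨b, hb, rfl⟩ := h1
    exact hM₂ b hb
  -- The prefix that the image under `φ` of a reduced word beginning with `x` will be shown to have.
  let pre : ι × Bool → List (ι × Bool) := fun x =>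
    if x.1 = i then (if x.2 then p ++ c else p ++ invRev c) else [x]
  let φ : FreeGroup ι →* FreeGroup ι := lift (Function.update of i (mk M))
  have hφi : φ (of i) = mk M := by simp [φ]
  have hφ : ∀ l, l ≠ i → φ (of l) = of l := fun l hl => by simp [φ, hl]
  -- Ping-pong: the prefix of the image determines the first letter well enough that the next letter
  -- of the word, acting on the left, never meets a cancellation beyond `p⁻¹ p`.
  have key : ∀ Z : List (ι × Bool), IsReduced Z →
      ∀ x ∈ Z.head?, ∃ Y, (φ (mk Z)).toWord = pre x ++ Y := by
    intro Z
    induction Z with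
    | nil => simp
    | cons x Z ih =>
      intro hZ x' hx'
      obtain rfl : x = x' := by simpa using hx'
      have ih := ih (hZ.infix ⟨[x], [], by simp⟩)
      have hmul : φ (mk (x :: Z)) = φ (mk [x]) * mk (φ (mk Z)).toWord := by
        rw [mk_toWord, ← _root_.map_mul, mul_mk]; rfl
      have hnil : Z = [] → (φ (mk Z)).toWord = [] := by
        rintro rfl
        rw [← one_eq_mk, _root_.map_one, toWord_one]
      have hchain : ∀ y ∈ Z.head?, x.1 = y.1 → x.2 = y.2 := by
        have := hZ
        rw [IsReduced, List.isChain_cons] at this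
        exact this.1
      obtain ⟨l, e⟩ := x
      by_cases hl : l = i
      · subst hl
        have hhead : (∀ a ∈ (φ (mk Z)).toWord.head?, a.1 ≠ l) ∨
            ∃ Y', (φ (mk Z)).toWord = pre (l, e) ++ Y' := by
          rcases Z with _ | ⟨y, Z⟩
          · left; simp [hnil rfl]
          · obtain ⟨Y, hY⟩ := ih y (by simp)
            have hch := hchain y (by simp)
            obtain ⟨l', e'⟩ := y
            by_cases hl' : l' = l
            · subst hl'
              obtain rfl : e = e' := hch rfl
              exact Or.inr ⟨Y, hY⟩
            · left
              rw [hY]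
              simp [pre, hl']
        rw [hmul]
        cases e with
        | true =>
          have h1 : φ (mk [(l, true)]) = mk (p ++ c ++ invRev p) := by rw [hpc]; exact hφi
          rw [h1]
          simp only [pre, if_true] at hhead ⊢
          exact exists_toWord_conj_mul_eq hc hcne (hpc ▸ hMred) (hpc ▸ hM₂) isReduced_toWord hhead
        | false =>
          have h1 : φ (mk [(l, false)]) = mk (p ++ invRev c ++ invRev p) := by
            rw [← hinv, ← inv_mk, ← hφi, ← _root_.map_inv]; simp [of, invRev]
          rw [h1]
          simp only [pre, if_true] at hhead ⊢
          refine exists_toWord_conj_mul_eq hc.invRev hc'ne (hinv ▸ hMred.invRev) ?_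
            isReduced_toWord hhead
          rw [← hinv, getLast?_invRev]
          intro a ha
          rw [Option.mem_def, Option.map_eq_some_iff] at ha
          obtain ⟨b, hb, rfl⟩ := ha
          exact hM₁ b hb
      · have h1 : φ (mk [(l, e)]) = mk [(l, e)] := by
          cases e with
          | true => exact hφ l hl
          | false =>
            have : (mk [(l, false)] : FreeGroup ι) = (of l)⁻¹ := by simp [of, invRev]
            rw [this, _root_.map_inv, hφ l hl]
        refine ⟨(φ (mk Z)).toWord, ?_⟩
        rw [hmul, h1, mul_mk, IsReduced.toWord_mk]
        · simp [pre, hl]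
        · rw [List.singleton_append, IsReduced, List.isChain_cons]
          refine ⟨?_, isReduced_toWord⟩
          intro a ha hla
          rcases Z with _ | ⟨y, Z⟩
          · simp [hnil rfl] at ha
          · obtain ⟨Y, hY⟩ := ih y (by simp)
            have hch := hchain y (by simp)
            obtain ⟨l', e'⟩ := y
            by_cases hl' : l' = i
            · exfalso
              have hai : a.1 = i := by
                rw [hY] at ha
                cases e' with
                | true =>
                  simp only [pre, hl', if_true] at ha
                  apply hpos
                  rw [List.head?_append_of_ne_nil _ (by simp [hcne])] at ha
                  exact ha
                | false =>
                  simp only [pre, hl', if_true] at ha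
                  apply hneg
                  rw [List.head?_append_of_ne_nil _ (by simp [hc'ne])] at ha
                  exact ha
              exact hl (hla.trans hai)
            · rw [hY] at ha
              simp only [pre, hl', if_false, List.singleton_append, List.head?_cons,
                Option.mem_def, Option.some.injEq] at ha
              subst ha
              exact hch hla
  -- `φ` fixes `B` pointwise and attains `M`, hence `s`; so its range is everything.
  have hrange : of i ∈ φ.range := by
    have hBr : B ≤ φ.range := by
      rw [hB, Subgroup.closure_le]
      rintro _ ⟨l, hl, rfl⟩
      exact ⟨of l, hφ l hl⟩
    have : Subgroup.closure (insert s ((of : ι → FreeGroup ι) '' {i}ᶜ)) ≤ φ.range := by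
      rw [Subgroup.closure_le, Set.insert_subset_iff]
      refine ⟨?_, Subgroup.subset_closure.trans hBr⟩
      rw [hs]
      exact mul_mem (mul_mem (hBr hγ) ⟨of i, hφi⟩) (hBr hδ)
    exact this (h ▸ Subgroup.mem_top _)
  obtain ⟨z, hz⟩ := hrange
  rw [← mk_toWord (x := z)] at hz
  have hkey := key z.toWord isReduced_toWord
  rw [hz, toWord_of] at hkey
  rcases hzw : z.toWord with _ | ⟨⟨l, e⟩, Z⟩
  · rw [hzw, ← one_eq_mk, _root_.map_one] at hz
    exact absurd hz (one_ne_of i)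
  obtain ⟨Y, hY⟩ := hkey (l, e) (by simp [hzw])
  have hli : l = i := by
    by_contra hl
    simp only [pre, hl, if_false, List.singleton_append, List.cons.injEq, Prod.mk.injEq] at hY
    exact hl hY.1.1.symm
  -- A preimage of `of i` begins with the letter `i`, so `p c^{±1}` is a prefix of a one-letter
  -- word.
  have hlen : p.length + c.length ≤ 1 := by
    have := congrArg List.length hY
    simp only [pre, hli, if_true] at this
    cases e <;> simp at this <;> omega
  have hclen : c.length ≠ 0 := by simpa using hcne
  have hp0 : p = [] := List.length_eq_zero_iff.1 (by omega)
  obtain ⟨x, hx⟩ := List.length_eq_one_iff.1 (show c.length = 1 by omega)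
  have hMx : M = [x] := by rw [← hpc, hp0, hx]; rfl
  have hxi : x.1 = i := hM₁ x (by simp [hMx])
  refine ⟨mk L₁, hγ, mk L₂, hδ, mk M, ?_, hs⟩
  obtain ⟨l', e'⟩ := x
  obtain rfl : l' = i := hxi
  rw [hMx]
  exact mk_singleton_eq _ _

/-- The number of occurrences of the letter `i` in the reduced word of `x`. -/
def letterCount (i : ι) (x : FreeGroup ι) : ℕ := x.toWord.countP fun p => p.1 = i

theorem letterCount_mul_le (i : ι) (x y : FreeGroup ι) :
    letterCount i (x * y) ≤ letterCount i x + letterCount i y := by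
  have := (toWord_mul_sublist x y).countP_le (p := fun p => decide (p.1 = i))
  rwa [List.countP_append] at this

theorem letterCount_inv (i : ι) (x : FreeGroup ι) : letterCount i x⁻¹ = letterCount i x := by
  rw [letterCount, toWord_inv, invRev, List.countP_reverse, List.countP_map]
  rfl

theorem letterCount_pow_le (i : ι) (x : FreeGroup ι) (m : ℕ) :
    letterCount i (x ^ m) ≤ m * letterCount i x := by
  induction m with
  | zero => simp [letterCount]
  | succ m ih =>
    rw [pow_succ, Nat.succ_mul]
    exact (letterCount_mul_le i _ _).trans (Nat.add_le_add_right ih _)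

theorem letterCount_eq_zero {i : ι} {x : FreeGroup ι}
    (hx : x ∈ Subgroup.closure ((of : ι → FreeGroup ι) '' {i}ᶜ)) : letterCount i x = 0 := by
  rw [letterCount, List.countP_eq_zero]
  intro p hp
  simpa using mem_closure_of_iff.1 hx p hp

/-- Strip from `g` its longest prefix of letters `i` and then its longest suffix free of `i`. If a
middle part `G` remains, the left-hand element is conjugate to the cyclically reduced word `G⁻¹ t G
V`, with at least three letters `i`, so its powers gain at least three such letters at each step.
Powers of a conjugate of `γ t' δ` gain at most one, up to a bounded error. -/
theorem exists_zpow_mul_mem_of_isConj {i : ι} {g v γ δ t t' : FreeGroup ι}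
    (hv : v ∈ Subgroup.closure ((of : ι → FreeGroup ι) '' {i}ᶜ)) (hv1 : v ≠ 1)
    (hγ : γ ∈ Subgroup.closure ((of : ι → FreeGroup ι) '' {i}ᶜ))
    (hδ : δ ∈ Subgroup.closure ((of : ι → FreeGroup ι) '' {i}ᶜ))
    (ht : t = of i ∨ t = (of i)⁻¹) (ht' : t' = of i ∨ t' = (of i)⁻¹)
    (h : IsConj (g⁻¹ * t * g * v) (γ * t' * δ)) :
    ∃ k : ℤ, of i ^ k * g ∈ Subgroup.closure ((of : ι → FreeGroup ι) '' {i}ᶜ) := by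
  set B := Subgroup.closure ((of : ι → FreeGroup ι) '' {i}ᶜ) with hB
  obtain ⟨L, R, hL, hR, hlast⟩ := List.exists_eq_append_getLast (fun a => a.1 ≠ i) g.toWord
  obtain ⟨Z, G, rfl, hZ, hG⟩ := List.exists_eq_append_head (fun a => a.1 = i) L
  have hg : g = mk Z * mk G * mk R := by rw [mul_mk, mul_mk, ← hL, mk_toWord]
  have hZi : mk Z ∈ Subgroup.zpowers (of i) := by
    have := mk_mem_closure (S := {i}) (L := Z) hZ
    rwa [Set.image_singleton, ← Subgroup.zpowers_eq_closure] at this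
  have hRB : mk R ∈ B := mk_mem_closure hR
  obtain ⟨k, hk⟩ := hZi
  dsimp only at hk
  rcases List.eq_nil_or_concat' G with rfl | ⟨G', a, hG'⟩
  · refine ⟨-k, ?_⟩
    rw [hg, ← hk, ← one_eq_mk, mul_one, zpow_neg, inv_mul_cancel_left]
    exact hRB
  exfalso
  have hGne : G ≠ [] := by simp [hG']
  have hGlast : ∀ a ∈ G.getLast?, a.1 = i := by
    intro a ha
    by_contra hai
    refine hlast a ?_ hai
    rw [List.getLast?_append, Option.mem_def.1 ha]; rfl
  have hGred : IsReduced G := (isReduced_toWord (x := g)).infix ⟨Z, R, by simp [hL]⟩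
  obtain ⟨e, he⟩ : ∃ e, t = mk [(i, e)] := by
    rcases ht with rfl | rfl
    · exact ⟨true, rfl⟩
    · exact ⟨false, by simp [of, invRev]⟩
  -- The prefix of letters `i` commutes with `t` and so disappears from `g⁻¹ t g`.
  have hcomm : mk Z * t = t * mk Z := by
    rw [← hk]
    rcases ht with rfl | rfl
    · exact ((Commute.refl (of i)).zpow_left k).eq
    · exact ((Commute.refl (of i)).zpow_left k).inv_right.eq
  set V := (mk R * v * (mk R)⁻¹).toWord with hV
  have hVB : ∀ p ∈ V, p.1 ≠ i := mem_closure_of_iff.1 (mul_mem (mul_mem hRB hv) (inv_mem hRB))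
  have hVne : V ≠ [] := by
    rw [hV, Ne, toWord_eq_nil_iff, mul_inv_eq_one, mul_eq_left]
    exact hv1
  set W := invRev G ++ ([(i, e)] ++ (G ++ V)) with hW
  have hWmk : mk W = mk R * (g⁻¹ * t * g * v) * (mk R)⁻¹ := by
    have h1 : mk V = mk R * v * (mk R)⁻¹ := mk_toWord
    have h2 : mk W = (mk G)⁻¹ * (t * (mk G * mk V)) := by
      rw [hW, ← mul_mk, ← mul_mk, ← mul_mk, ← inv_mk, he]
    have h3 : (mk Z)⁻¹ * t * mk Z = t := by rw [mul_assoc, ← hcomm, inv_mul_cancel_left]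
    rw [h2, h1, hg]
    nth_rewrite 1 [← h3]
    group
  have hWred : IsReduced W := by
    have hVh : ∀ b ∈ V.head?, b.1 ≠ i := fun b hb => hVB b (List.mem_of_mem_head? hb)
    have h1 : IsReduced (G ++ V) := by
      rw [IsReduced, List.isChain_append]
      exact ⟨hGred, isReduced_toWord, fun a ha b hb hab =>
        absurd (hab.symm.trans (hGlast a ha)) (hVh b hb)⟩
    have h2 : IsReduced ([(i, e)] ++ (G ++ V)) := by
      rw [IsReduced, List.isChain_append]
      refine ⟨IsReduced.singleton, h1, ?_⟩
      intro a ha b hb hab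
      rw [List.head?_append_of_ne_nil _ hGne] at hb
      obtain rfl : (i, e) = a := by simpa using ha
      exact absurd hab.symm (hG b hb)
    rw [hW, IsReduced, List.isChain_append]
    refine ⟨hGred.invRev, h2, ?_⟩
    intro a ha b hb hab
    obtain rfl : (i, e) = b := by simpa using hb
    rw [getLast?_invRev, Option.mem_def, Option.map_eq_some_iff] at ha
    obtain ⟨c, hc, rfl⟩ := ha
    exact absurd hab (hG c hc)
  -- `W` begins with a letter `i` and ends in `V`, which has none. This is where `v ≠ 1` is needed.
  have hWcyc : IsCyclicallyReduced W := by
    refine ⟨hWred, ?_⟩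
    intro a ha b hb hab
    have hane : a.1 ≠ i := by
      refine hVB a (List.mem_of_mem_getLast? ?_)
      rwa [hW, List.getLast?_append_of_ne_nil _ (by simp),
        List.getLast?_append_of_ne_nil _ (by simp [hGne]),
        List.getLast?_append_of_ne_nil _ hVne] at ha
    have hGi : invRev G ≠ [] := fun h0 => hGne (by
      rw [← invRev_invRev (L₁ := G), h0, invRev_empty])
    rw [hW, List.head?_append_of_ne_nil _ hGi, head?_invRev, Option.mem_def,
      Option.map_eq_some_iff] at hb
    obtain ⟨c, hc, rfl⟩ := hb
    exact absurd (hab.trans (hGlast c hc)) hane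
  have hWcount : 3 ≤ W.countP fun p => p.1 = i := by
    have hG1 : 1 ≤ G.countP fun p => p.1 = i := by
      rw [Nat.one_le_iff_ne_zero, ← Nat.pos_iff_ne_zero, List.countP_pos_iff]
      exact ⟨a, by simp [hG'], by simpa using hGlast a (by simp [hG'])⟩
    have hG2 : (invRev G).countP (fun p => p.1 = i) = G.countP fun p => p.1 = i := by
      rw [invRev, List.countP_reverse, List.countP_map]; rfl
    rw [hW]
    simp only [List.countP_append, hG2, List.countP_singleton, decide_true, if_true]
    omega
  have hpow : ∀ m, m * 3 ≤ letterCount i (mk W ^ m) := by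
    intro m
    rw [letterCount, pow_mk, IsReduced.toWord_mk (hWcyc.flatten_replicate m).isReduced]
    rw [List.countP_flatten, List.map_replicate, List.sum_replicate, smul_eq_mul]
    exact Nat.mul_le_mul_left m hWcount
  obtain ⟨x, hx⟩ := isConj_iff.1 h
  have hconj : mk W = (mk R * x⁻¹ * γ) * (t' * (δ * γ)) * (mk R * x⁻¹ * γ)⁻¹ := by
    rw [hWmk, show g⁻¹ * t * g * v = x⁻¹ * (γ * t' * δ) * x by rw [← hx]; group]
    group
  set y := mk R * x⁻¹ * γ
  have hs : letterCount i (t' * (δ * γ)) ≤ 1 := by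
    refine (letterCount_mul_le i _ _).trans ?_
    rw [letterCount_eq_zero (mul_mem hδ hγ)]
    rcases ht' with rfl | rfl
    · simp [letterCount]
    · rw [letterCount_inv]; simp [letterCount]
  have hup : ∀ m, letterCount i (mk W ^ m) ≤ 2 * letterCount i y + m := by
    intro m
    rw [hconj, conj_pow]
    have h1 := letterCount_mul_le i (y * (t' * (δ * γ)) ^ m) y⁻¹
    have h2 := letterCount_mul_le i y ((t' * (δ * γ)) ^ m)
    have h3 := letterCount_pow_le i (t' * (δ * γ)) m
    have h4 := Nat.mul_le_mul_left m hs
    rw [letterCount_inv] at h1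
    omega
  -- With `q` the number of letters `i` in `y`, the exponent `m = 2 q + 1` violates `3 m ≤ 2 q + m`.
  have h1 := hpow (2 * letterCount i y + 1)
  have h2 := hup (2 * letterCount i y + 1)
  omega

/-- After a power of `of i` is removed on the right, the rest `G` of `x` still commutes with `of i`.
The word `G i G⁻¹` is reduced and represents `of i`, so `G` is empty. -/
theorem mem_zpowers_of_commute {i : ι} {x : FreeGroup ι} (h : Commute x (of i)) :
    x ∈ Subgroup.zpowers (of i) := by
  obtain ⟨G, Z, hL, hZ, hG⟩ := List.exists_eq_append_getLast (fun a => a.1 = i) x.toWord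
  have hx : x = mk G * mk Z := by rw [mul_mk, ← hL, mk_toWord]
  have hZi : mk Z ∈ Subgroup.zpowers (of i) := by
    have := mk_mem_closure (S := {i}) (L := Z) hZ
    rwa [Set.image_singleton, ← Subgroup.zpowers_eq_closure] at this
  rcases List.eq_nil_or_concat' G with rfl | ⟨G', a, hG'⟩
  · rw [hx]; exact mul_mem (one_mem _) hZi
  exfalso
  have hGred : IsReduced G := (isReduced_toWord (x := x)).infix ⟨[], Z, by simp [hL]⟩
  have hcomm : Commute (mk Z) (of i) := by
    obtain ⟨k, hk⟩ := hZi
    rw [← hk]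
    exact (Commute.refl (of i)).zpow_left k
  have hGc : Commute (mk G) (of i) := by
    have : mk G = x * (mk Z)⁻¹ := by rw [hx, mul_inv_cancel_right]
    rw [this]
    exact h.mul_left hcomm.inv_left
  have hred : IsReduced (G ++ ([(i, true)] ++ invRev G)) := by
    rw [IsReduced, List.isChain_append]
    refine ⟨hGred, ?_, ?_⟩
    · rw [List.isChain_append]
      refine ⟨IsReduced.singleton, hGred.invRev, ?_⟩
      intro b hb c hc hbc
      rw [head?_invRev, Option.mem_def, Option.map_eq_some_iff] at hc
      obtain ⟨c, hc, rfl⟩ := hc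
      obtain rfl : (i, true) = b := by simpa using hb
      exact absurd hbc.symm (hG c hc)
    · intro b hb c hc hbc
      obtain rfl : (i, true) = c := by simpa using hc
      exact absurd hbc (hG b hb)
  have hw := hred.toWord_mk
  have : mk (G ++ ([(i, true)] ++ invRev G)) = of i := by
    rw [← mul_mk, ← mul_mk, ← inv_mk]
    change mk G * (of i * (mk G)⁻¹) = of i
    rw [← mul_assoc, hGc.eq, mul_inv_cancel_right]
  rw [this, toWord_of] at hw
  have := congrArg List.length hw
  simp [hG'] at this
  omega

end

end FreeGroup

namespace FreeFactors

/-! ### Bases of free groups as families of elements -/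

/-- The family `c` is a free basis of the group `G`. -/
def IsBasis {ι G : Type*} [Group G] (c : ι → G) : Prop :=
  Function.Bijective (FreeGroup.lift c)

/-- The subgroup generated by the members of the family `c` with index in `S`. -/
abbrev gen {ι G : Type*} [Group G] (c : ι → G) (S : Set ι) : Subgroup G :=
  Subgroup.closure (c '' S)

variable {ι G H : Type*} [Group G] [Group H] {c d : ι → G}

theorem mem_gen {S : Set ι} {i : ι} (hi : i ∈ S) : c i ∈ gen c S :=
  Subgroup.subset_closure ⟨i, hi, rfl⟩

theorem gen_mono {S T : Set ι} (h : S ⊆ T) : gen c S ≤ gen c T :=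
  Subgroup.closure_mono (Set.image_mono h)

theorem gen_le {S : Set ι} {K : Subgroup G} : gen c S ≤ K ↔ ∀ i ∈ S, c i ∈ K := by
  rw [Subgroup.closure_le, Set.image_subset_iff]; rfl

theorem gen_congr {S : Set ι} (h : ∀ i ∈ S, c i = d i) : gen c S = gen d S := by
  rw [gen, Set.image_congr h]

theorem gen_singleton (i : ι) : gen c {i} = Subgroup.zpowers (c i) := by
  rw [gen, Set.image_singleton, ← Subgroup.zpowers_eq_closure]

theorem map_mem_of_mem_gen {S : Set ι} {x : G} (hx : x ∈ gen c S) (φ : G →* H) {K : Subgroup H}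
    (h : ∀ i ∈ S, φ (c i) ∈ K) : φ x ∈ K :=
  (gen_le (K := K.comap φ)).2 h hx

theorem map_eq_self_of_mem_gen {S : Set ι} {x : G} (hx : x ∈ gen c S) (φ : G →* G)
    (h : ∀ i ∈ S, φ (c i) = c i) : φ x = x :=
  (gen_le (K := MonoidHom.eqLocus φ (MonoidHom.id G))).2 h hx

theorem conjBy_gen (g : G) (S : Set ι) :
    conjBy g (gen c S) = gen (fun i => g * c i * g⁻¹) S := by
  rw [conjBy, gen, MonoidHom.map_closure, Set.image_image]
  rfl

theorem conjBy_zpowers (g x : G) :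
    conjBy g (Subgroup.zpowers x) = Subgroup.zpowers (g * x * g⁻¹) := by
  rw [conjBy, MonoidHom.map_zpowers]; rfl

theorem IsFreeProduct.sup_eq_top {A B : Subgroup G} (h : IsFreeProduct A B) : A ⊔ B = ⊤ := by
  have := MonoidHom.range_eq_top.2 h.2
  rwa [Monoid.Coprod.range_lift, Subgroup.range_subtype, Subgroup.range_subtype] at this

theorem _root_.FreeGroupBasis.isBasis (b : FreeGroupBasis ι G) : IsBasis b := by
  have : FreeGroup.lift b = b.repr.symm.toMonoidHom := by ext i; simp; rfl
  rw [IsBasis, this]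
  exact b.repr.symm.bijective

namespace IsBasis

/-- The isomorphism with the free group given by a basis. -/
noncomputable def equiv (hc : IsBasis c) : FreeGroup ι ≃* G := MulEquiv.ofBijective _ hc

theorem equiv_of (hc : IsBasis c) (i : ι) : hc.equiv (FreeGroup.of i) = c i :=
  FreeGroup.lift_apply_of

/-- The basis as a bundled one. -/
noncomputable def toFreeGroupBasis (hc : IsBasis c) : FreeGroupBasis ι G :=
  FreeGroupBasis.ofRepr hc.equiv.symm

theorem coe_toFreeGroupBasis (hc : IsBasis c) : ⇑hc.toFreeGroupBasis = c :=
  funext hc.equiv_of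

/-- The homomorphism with prescribed values on a basis. -/
noncomputable def lift (hc : IsBasis c) (f : ι → H) : G →* H :=
  (FreeGroup.lift f).comp hc.equiv.symm.toMonoidHom

theorem lift_apply (hc : IsBasis c) (f : ι → H) (i : ι) : hc.lift f (c i) = f i := by
  have : hc.equiv.symm (c i) = FreeGroup.of i := by
    rw [MulEquiv.symm_apply_eq, equiv_of]
  simp [lift, this]

theorem gen_univ (hc : IsBasis c) : gen c Set.univ = ⊤ := by
  rw [gen, Set.image_univ, ← FreeGroup.range_lift_eq_closure]
  exact MonoidHom.range_eq_top.2 hc.2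

theorem hom_ext (hc : IsBasis c) {φ ψ : G →* H} (h : ∀ i, φ (c i) = ψ (c i)) : φ = ψ := by
  rw [← MonoidHom.cancel_right hc.2]
  ext i
  simpa using h i

theorem of_hom (hc : IsBasis c) (φ ψ : G →* G) (h₁ : ∀ i, φ (c i) = d i)
    (h₂ : ∀ i, ψ (d i) = c i) (h₃ : ∀ i, φ (ψ (c i)) = c i) : IsBasis d := by
  have h₄ : φ.comp ψ = MonoidHom.id G := hc.hom_ext h₃
  have h₅ : ψ.comp φ = MonoidHom.id G := hc.hom_ext fun i => by simp [h₁, h₂]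
  have h₆ : FreeGroup.lift d = φ.comp (FreeGroup.lift c) := by ext i; simp [h₁]
  rw [IsBasis, h₆]
  exact (MonoidHom.toMulEquiv φ ψ h₅ h₄).bijective.comp hc

theorem map (hc : IsBasis c) (e : G ≃* H) : IsBasis fun i => e (c i) := by
  have : FreeGroup.lift (fun i => e (c i)) = e.toMonoidHom.comp (FreeGroup.lift c) := by
    ext i; simp
  rw [IsBasis, this]
  exact e.bijective.comp hc

theorem conj (hc : IsBasis c) (g : G) : IsBasis fun i => g * c i * g⁻¹ :=
  hc.map (MulAut.conj g)

theorem comp_equiv {κ : Type*} (hc : IsBasis c) (e : κ ≃ ι) : IsBasis (c ∘ e) := by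
  have : FreeGroup.lift (c ∘ e) = (FreeGroup.lift c).comp (FreeGroup.map e) := by
    ext i; simp
  rw [IsBasis, this]
  exact hc.comp (FreeGroup.map_bijective e.bijective)

theorem of_eq_or_eq_inv (hc : IsBasis c) (h : ∀ i, d i = c i ∨ d i = (c i)⁻¹) : IsBasis d := by
  have h₂ : ∀ i, hc.lift d (d i) = c i := fun i => by
    rcases h i with h | h
    · exact (congrArg _ h).trans (by rw [lift_apply, h])
    · exact (congrArg _ h).trans (by rw [_root_.map_inv, lift_apply, h, inv_inv])
  exact hc.of_hom (hc.lift d) (hc.lift d) (hc.lift_apply d) h₂ fun i => by rw [lift_apply, h₂]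

theorem gen_eq_map (hc : IsBasis c) (S : Set ι) :
    gen c S = (gen FreeGroup.of S).map hc.equiv.toMonoidHom := by
  rw [gen, gen, MonoidHom.map_closure, Set.image_image]
  congr 1
  exact Set.image_congr fun i _ => (hc.equiv_of i).symm

theorem symm_mem_gen_iff (hc : IsBasis c) {S : Set ι} {x : G} :
    hc.equiv.symm x ∈ gen FreeGroup.of S ↔ x ∈ gen c S := by
  rw [hc.gen_eq_map]
  exact (Subgroup.mem_map_equiv (f := hc.equiv)).symm

/-- The subgroup generated by a part of a basis is free on it. -/
noncomputable def freeGroupBasisGen (hc : IsBasis c) (S : Set ι) : FreeGroupBasis S (gen c S) :=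
  FreeGroupBasis.ofRepr <| MulEquiv.symm <|
    (MonoidHom.ofInjective (f := (FreeGroup.lift c).comp (FreeGroup.map ((↑) : S → ι)))
      (hc.1.comp (FreeGroup.map_injective Subtype.val_injective))).trans <|
    MulEquiv.subgroupCongr (by
      rw [MonoidHom.range_comp, FreeGroup.range_map, MonoidHom.map_closure, Set.image_image,
        Subtype.range_coe]
      simp)

/-- The span of a part of a basis and that of its complement are complementary free factors. -/
theorem isFreeProduct_gen (hc : IsBasis c) (S : Set ι) :
    IsFreeProduct (gen c S) (gen c Sᶜ) := by
  classical
  let f : ι → Monoid.Coprod (gen c S) (gen c Sᶜ) := fun i =>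
    if h : i ∈ S then Monoid.Coprod.inl ⟨c i, mem_gen h⟩
    else Monoid.Coprod.inr ⟨c i, mem_gen (Set.mem_compl h)⟩
  let ψ := hc.lift f
  let φ := Monoid.Coprod.lift (gen c S).subtype (gen c Sᶜ).subtype
  have h₁ : φ.comp ψ = MonoidHom.id G := hc.hom_ext fun i => by
    simp only [MonoidHom.comp_apply, ψ, lift_apply, f, MonoidHom.id_apply]
    split_ifs <;> simp [φ]
  have h₂ : ψ.comp φ = MonoidHom.id _ := by
    apply Monoid.Coprod.hom_ext
    · refine MonoidHom.ext ?_
      rintro ⟨x, hx⟩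
      change ψ (φ (Monoid.Coprod.inl ⟨x, hx⟩)) = Monoid.Coprod.inl ⟨x, hx⟩
      simp only [φ, Monoid.Coprod.lift_apply_inl, Subgroup.subtype_apply]
      induction hx using Subgroup.closure_induction with
      | mem x hx =>
        obtain ⟨i, hi, rfl⟩ := hx
        simp [ψ, lift_apply, f, hi]
      | one => rw [_root_.map_one]; exact (_root_.map_one Monoid.Coprod.inl).symm
      | mul x y hx hy ihx ihy =>
        rw [_root_.map_mul, ihx, ihy, ← _root_.map_mul]; rfl
      | inv x hx ihx => rw [_root_.map_inv, ihx, ← _root_.map_inv]; rfl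
    · refine MonoidHom.ext ?_
      rintro ⟨x, hx⟩
      change ψ (φ (Monoid.Coprod.inr ⟨x, hx⟩)) = Monoid.Coprod.inr ⟨x, hx⟩
      simp only [φ, Monoid.Coprod.lift_apply_inr, Subgroup.subtype_apply]
      induction hx using Subgroup.closure_induction with
      | mem x hx =>
        obtain ⟨i, hi, rfl⟩ := hx
        have hi' : i ∉ S := hi
        simp [ψ, lift_apply, f, hi']
      | one => rw [_root_.map_one]; exact (_root_.map_one Monoid.Coprod.inr).symm
      | mul x y hx hy ihx ihy =>
        rw [_root_.map_mul, ihx, ihy, ← _root_.map_mul]; rfl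
      | inv x hx ihx => rw [_root_.map_inv, ihx, ← _root_.map_inv]; rfl
  exact (MonoidHom.toMulEquiv φ ψ h₂ h₁).bijective

/-- A basis element commutes only with its powers. -/
theorem mem_zpowers_of_commute (hc : IsBasis c) {i : ι} {x : G} (h : Commute x (c i)) :
    x ∈ Subgroup.zpowers (c i) := by
  classical
  have h' : Commute (hc.equiv.symm x) (FreeGroup.of i) := by
    have := h.map hc.equiv.symm
    rwa [← hc.equiv_of, MulEquiv.symm_apply_apply] at this
  obtain ⟨k, hk⟩ := FreeGroup.mem_zpowers_of_commute h'
  refine ⟨k, ?_⟩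
  have := congrArg hc.equiv hk
  simpa [equiv_of] using this

theorem exists_eq_zpow_of_commute (hc : IsBasis c) {i : ι} {x : G} (h : x * c i = c i * x) :
    ∃ k : ℤ, x = c i ^ k := by
  obtain ⟨k, hk⟩ := hc.mem_zpowers_of_commute (x := x) (i := i) h
  exact ⟨k, hk.symm⟩

theorem eq_mul_of_mul_of_closure_eq_top (hc : IsBasis c) {i : ι} {s : G}
    (h : Subgroup.closure (insert s (c '' {i}ᶜ)) = ⊤) :
    ∃ γ ∈ gen c {i}ᶜ, ∃ δ ∈ gen c {i}ᶜ, ∃ t, (t = c i ∨ t = (c i)⁻¹) ∧ s = γ * t * δ := by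
  classical
  have h' : Subgroup.closure (insert (hc.equiv.symm s) (FreeGroup.of '' {i}ᶜ)) = ⊤ := by
    have h1 := congrArg (Subgroup.map hc.equiv.symm.toMonoidHom) h
    rw [MonoidHom.map_closure, Subgroup.map_top_of_surjective _ hc.equiv.symm.surjective,
      Set.image_insert_eq, Set.image_image] at h1
    rw [← h1]
    congr 2
    refine Set.image_congr fun j _ => ?_
    change _ = hc.equiv.symm (c j)
    rw [← hc.equiv_of, MulEquiv.symm_apply_apply]
  obtain ⟨γ, hγ, δ, hδ, t, ht, hs⟩ := FreeGroup.eq_mul_of_mul_of_closure_eq_top h'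
  refine ⟨hc.equiv γ, ?_, hc.equiv δ, ?_, hc.equiv t, ?_, ?_⟩
  · rwa [← hc.symm_mem_gen_iff, MulEquiv.symm_apply_apply]
  · rwa [← hc.symm_mem_gen_iff, MulEquiv.symm_apply_apply]
  · rcases ht with rfl | rfl
    · exact Or.inl (hc.equiv_of i)
    · exact Or.inr (by rw [_root_.map_inv, hc.equiv_of])
  · rw [← _root_.map_mul, ← _root_.map_mul, ← hs, MulEquiv.apply_symm_apply]

theorem exists_zpow_mul_mem_of_isConj (hc : IsBasis c) {i : ι} {g v γ δ t t' : G}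
    (hv : v ∈ gen c {i}ᶜ) (hv1 : v ≠ 1) (hγ : γ ∈ gen c {i}ᶜ) (hδ : δ ∈ gen c {i}ᶜ)
    (ht : t = c i ∨ t = (c i)⁻¹) (ht' : t' = c i ∨ t' = (c i)⁻¹)
    (h : IsConj (g⁻¹ * t * g * v) (γ * t' * δ)) : ∃ k : ℤ, c i ^ k * g ∈ gen c {i}ᶜ := by
  classical
  have hci : hc.equiv.symm (c i) = FreeGroup.of i := by
    rw [← hc.equiv_of, MulEquiv.symm_apply_apply]
  have htr : ∀ {t : G}, t = c i ∨ t = (c i)⁻¹ →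
      hc.equiv.symm t = FreeGroup.of i ∨ hc.equiv.symm t = (FreeGroup.of i)⁻¹ := by
    rintro t (rfl | rfl)
    · exact Or.inl hci
    · exact Or.inr (by rw [_root_.map_inv, hci])
  obtain ⟨k, hk⟩ := FreeGroup.exists_zpow_mul_mem_of_isConj (hc.symm_mem_gen_iff.2 hv)
    (by simpa using hv1) (hc.symm_mem_gen_iff.2 hγ) (hc.symm_mem_gen_iff.2 hδ) (htr ht) (htr ht')
    (g := hc.equiv.symm g) (by simpa using MonoidHom.map_isConj hc.equiv.symm.toMonoidHom h)
  refine ⟨k, ?_⟩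
  rw [← hc.symm_mem_gen_iff, _root_.map_mul, map_zpow, hci]
  exact hk

/-! ### Exchange of one basis element -/

section
variable [DecidableEq ι]

/-- Replacing a basis element `c i` by `γ (c i)^{±1} δ` gives a basis. -/
theorem update (hc : IsBasis c) {i : ι} {γ δ t : G} (hγ : γ ∈ gen c {i}ᶜ) (hδ : δ ∈ gen c {i}ᶜ)
    (ht : t = c i ∨ t = (c i)⁻¹) : IsBasis (Function.update c i (γ * t * δ)) := by
  have hfix : ∀ (f : ι → G), (∀ j ≠ i, f j = c j) → ∀ x ∈ gen c {i}ᶜ, hc.lift f x = x :=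
    fun f hf x hx => map_eq_self_of_mem_gen hx _ fun j hj => by rw [lift_apply, hf j hj]
  have hupd : ∀ (y : G), ∀ j ≠ i, Function.update c i y j = c j :=
    fun y j hj => Function.update_of_ne hj _ _
  have hφi : ∀ y, hc.lift (Function.update c i y) (c i) = y := fun y => by simp [lift_apply]
  rcases ht with rfl | rfl
  · refine hc.of_hom (hc.lift (Function.update c i (γ * c i * δ)))
      (hc.lift (Function.update c i (γ⁻¹ * c i * δ⁻¹))) (hc.lift_apply _) ?_ ?_
    · intro j
      by_cases hj : j = i
      · subst hj
        rw [Function.update_self, _root_.map_mul, _root_.map_mul, hφi,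
          hfix _ (hupd _) _ hγ, hfix _ (hupd _) _ hδ]
        group
      · rw [hupd _ j hj, lift_apply, hupd _ j hj]
    · intro j
      by_cases hj : j = i
      · subst hj
        rw [hφi, _root_.map_mul, _root_.map_mul, hφi, _root_.map_inv, _root_.map_inv,
          hfix _ (hupd _) _ hγ, hfix _ (hupd _) _ hδ]
        group
      · rw [lift_apply, hupd _ j hj, lift_apply, hupd _ j hj]
  -- The inverse map comes from solving `s = γ (c i)⁻¹ δ` for `c i = δ s⁻¹ γ`, which exchanges `γ`
  -- and `δ`.
  · refine hc.of_hom (hc.lift (Function.update c i (γ * (c i)⁻¹ * δ)))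
      (hc.lift (Function.update c i (δ * (c i)⁻¹ * γ))) (hc.lift_apply _) ?_ ?_
    · intro j
      by_cases hj : j = i
      · subst hj
        rw [Function.update_self, _root_.map_mul, _root_.map_mul, _root_.map_inv, hφi,
          hfix _ (hupd _) _ hγ, hfix _ (hupd _) _ hδ]
        group
      · rw [hupd _ j hj, lift_apply, hupd _ j hj]
    · intro j
      by_cases hj : j = i
      · subst hj
        rw [hφi, _root_.map_mul, _root_.map_mul, _root_.map_inv, hφi,
          hfix _ (hupd _) _ hγ, hfix _ (hupd _) _ hδ]
        group
      · rw [lift_apply, hupd _ j hj, lift_apply, hupd _ j hj]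

theorem update_of_closure_eq_top (hc : IsBasis c) {i : ι} {s : G}
    (h : Subgroup.closure (insert s (c '' {i}ᶜ)) = ⊤) : IsBasis (Function.update c i s) := by
  obtain ⟨γ, hγ, δ, hδ, t, ht, rfl⟩ := hc.eq_mul_of_mul_of_closure_eq_top h
  exact hc.update hγ hδ ht

end

/-- The retraction to the span of a part of a basis that kills the other basis elements. -/
noncomputable def retract (hc : IsBasis c) (S : Set ι) : G →* G :=
  open Classical in hc.lift fun i => if i ∈ S then c i else 1

theorem retract_of_mem (hc : IsBasis c) {S : Set ι} {i : ι} (hi : i ∈ S) :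
    hc.retract S (c i) = c i := by
  rw [retract, lift_apply, if_pos hi]

theorem retract_of_notMem (hc : IsBasis c) {S : Set ι} {i : ι} (hi : i ∉ S) :
    hc.retract S (c i) = 1 := by
  rw [retract, lift_apply, if_neg hi]

theorem retract_eq_self (hc : IsBasis c) {S : Set ι} {x : G} (hx : x ∈ gen c S) :
    hc.retract S x = x :=
  map_eq_self_of_mem_gen hx _ fun _ hi => hc.retract_of_mem hi

theorem retract_mem_inter (hc : IsBasis c) {S T : Set ι} {x : G} (hx : x ∈ gen c T) :
    hc.retract S x ∈ gen c (S ∩ T) := by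
  refine map_mem_of_mem_gen hx _ fun i hi => ?_
  by_cases hS : i ∈ S
  · rw [hc.retract_of_mem hS]; exact mem_gen ⟨hS, hi⟩
  · rw [hc.retract_of_notMem hS]; exact one_mem _

theorem retract_mem (hc : IsBasis c) (S : Set ι) (x : G) : hc.retract S x ∈ gen c S := by
  have := hc.retract_mem_inter (S := S) (hc.gen_univ ▸ Subgroup.mem_top x)
  rwa [Set.inter_univ] at this

/-- The exponent sum of the basis element `c j`. -/
noncomputable def expo (hc : IsBasis c) (j : ι) : G →* Multiplicative ℤ :=
  open Classical in hc.lift fun i => if i = j then Multiplicative.ofAdd 1 else 1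

theorem expo_self (hc : IsBasis c) (j : ι) : hc.expo j (c j) = Multiplicative.ofAdd 1 := by
  rw [expo, lift_apply, if_pos rfl]

theorem expo_of_ne (hc : IsBasis c) {i j : ι} (h : i ≠ j) : hc.expo j (c i) = 1 := by
  rw [expo, lift_apply, if_neg h]

theorem expo_conj (hc : IsBasis c) (j : ι) (g x : G) : hc.expo j (g * x * g⁻¹) = hc.expo j x := by
  rw [_root_.map_mul, _root_.map_mul, mul_right_comm, ← _root_.map_mul, mul_inv_cancel,
    _root_.map_one, one_mul]

theorem expo_eq_of_isConj (hc : IsBasis c) (j : ι) {x y : G} (h : IsConj x y) :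
    hc.expo j x = hc.expo j y :=
  isConj_iff_eq.1 (MonoidHom.map_isConj _ h)

theorem expo_zpow_eq_one (hc : IsBasis c) {j : ι} {k : ℤ} (h : hc.expo j (c j ^ k) = 1) :
    k = 0 := by
  rw [map_zpow, expo_self] at h
  have := congrArg Multiplicative.toAdd h
  simpa using this

theorem expo_eq_one_of_mem (hc : IsBasis c) {j : ι} {S : Set ι} (hj : j ∉ S) {x : G}
    (hx : x ∈ gen c S) : hc.expo j x = 1 := by
  have := map_mem_of_mem_gen hx (hc.expo j) (K := ⊥) fun i hi => by
    rw [Subgroup.mem_bot]; exact hc.expo_of_ne (by rintro rfl; exact hj hi)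
  exact Subgroup.mem_bot.1 this

theorem mem_gen_iff (hc : IsBasis c) {j : ι} {S : Set ι} : c j ∈ gen c S ↔ j ∈ S := by
  refine ⟨fun h => ?_, mem_gen⟩
  by_contra hj
  have := hc.expo_eq_one_of_mem hj h
  rw [expo_self] at this
  simp at this

theorem zpow_injective (hc : IsBasis c) (j : ι) : Function.Injective fun k : ℤ => c j ^ k := by
  intro k l h
  have h' : c j ^ (k - l) = 1 := by
    rw [zpow_sub]; exact mul_inv_eq_one.2 h
  have := hc.expo_zpow_eq_one (j := j) (k := k - l) (by rw [h', _root_.map_one])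
  omega

/-- If a conjugate of the basis element `c i` generates the group together with the other basis
elements, it is a conjugate by an element of the span of these. -/
theorem exists_conj_eq_of_closure_eq_top (hc : IsBasis c) {i : ι} {y : G}
    (h : Subgroup.closure (insert (y * c i * y⁻¹) (c '' {i}ᶜ)) = ⊤) :
    ∃ γ ∈ gen c {i}ᶜ, y * c i * y⁻¹ = γ * c i * γ⁻¹ := by
  obtain ⟨γ, hγ, δ, hδ, t, ht, hs⟩ := hc.eq_mul_of_mul_of_closure_eq_top h
  have hni : i ∉ ({i}ᶜ : Set ι) := by simp
  have h1 : hc.retract {i}ᶜ (y * c i * y⁻¹) = 1 := by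
    rw [_root_.map_mul, _root_.map_mul, hc.retract_of_notMem hni, mul_one, _root_.map_inv,
      mul_inv_cancel]
  have h2 : hc.retract {i}ᶜ t = 1 := by
    rcases ht with rfl | rfl
    · exact hc.retract_of_notMem hni
    · rw [_root_.map_inv, hc.retract_of_notMem hni, inv_one]
  -- Killing `c i` kills its conjugate and leaves `γ δ`.
  have h3 : γ * δ = 1 := by
    rw [hs, _root_.map_mul, _root_.map_mul, h2, hc.retract_eq_self hγ, hc.retract_eq_self hδ,
      mul_one] at h1
    exact h1
  obtain rfl : δ = γ⁻¹ := (inv_eq_of_mul_eq_one_right h3).symm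
  refine ⟨γ, hγ, ?_⟩
  rcases ht with rfl | rfl
  · exact hs
  -- The exponent sum of `c i` rules out the inverse.
  · exfalso
    have := congrArg (hc.expo i) hs
    rw [expo_conj, expo_conj, _root_.map_inv, expo_self] at this
    have := congrArg Multiplicative.toAdd this
    simp at this

/-- The hypothesis makes `p (c j) p⁻¹` an exchange partner of `c j`, hence a conjugate of `c j` by
an element of the span of the others. Retracted to the span of `c i` and `c j`, the conjugating
element becomes a power of `c i`, and it differs from `p` by something that centralises `c j`. -/
theorem eq_zpow_mul_zpow_of_mem_closure (hc : IsBasis c) {i j : ι} (hij : i ≠ j) {p : G}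
    (hp : p ∈ gen c {i, j}) (h : c j ∈ Subgroup.closure {c i, p * c j * p⁻¹}) :
    ∃ α κ : ℤ, p = c i ^ α * c j ^ κ := by
  have htop : Subgroup.closure (insert (p * c j * p⁻¹) (c '' {j}ᶜ)) = ⊤ := by
    rw [eq_top_iff, ← hc.gen_univ, gen_le]
    intro l _
    by_cases hl : l = j
    · subst hl
      refine Subgroup.closure_mono ?_ h
      rintro x (rfl | rfl)
      · exact Or.inr ⟨i, hij, rfl⟩
      · exact Or.inl rfl
    · exact Subgroup.subset_closure (Or.inr ⟨l, hl, rfl⟩)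
  obtain ⟨γ, hγ, hs⟩ := hc.exists_conj_eq_of_closure_eq_top htop
  have h1 := congrArg (hc.retract {i, j}) hs
  have h2 : hc.retract {i, j} γ ∈ gen c {i} := by
    refine gen_mono ?_ (hc.retract_mem_inter hγ)
    rintro l ⟨rfl | rfl, hl⟩
    · rfl
    · exact absurd rfl hl
  rw [gen_singleton] at h2
  obtain ⟨α, hα⟩ := h2
  dsimp only at hα
  rw [_root_.map_mul, _root_.map_mul, _root_.map_inv, _root_.map_mul, _root_.map_mul,
    _root_.map_inv, hc.retract_eq_self hp, hc.retract_of_mem (by simp), ← hα] at h1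
  have h3 : (c i ^ α)⁻¹ * p * c j = c j * ((c i ^ α)⁻¹ * p) := by
    calc (c i ^ α)⁻¹ * p * c j = (c i ^ α)⁻¹ * (p * c j * p⁻¹) * p := by group
      _ = _ := by rw [h1]; group
  obtain ⟨κ, hκ⟩ := hc.exists_eq_zpow_of_commute h3
  exact ⟨α, κ, by rw [← hκ, mul_inv_cancel_left]⟩

end IsBasis

end FreeFactors

namespace FreeFactors

variable {ι G : Type*} [Group G] {a b : ι → G}

/-! ### Bases with conjugate members and conjugate partial spans -/

/-- The base case of the simultaneous conjugation below. Once the two spans coincide, the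
conjugators can be taken inside the common span, and their quotient has the form `(a i)^α (a j)^κ`:
the first factor can be moved to one side and the second to the other. -/
theorem exists_conj_pair (ha : IsBasis a) {i j : ι} (hij : i ≠ j)
    (hi : IsConj (a i) (b i)) (hj : IsConj (a j) (b j))
    (h : ∃ g, conjBy g (gen a {i, j}) = gen b {i, j}) :
    ∃ g, b i = g * a i * g⁻¹ ∧ b j = g * a j * g⁻¹ := by
  obtain ⟨g, hg⟩ := h
  obtain ⟨x, hx⟩ := isConj_iff.1 hi
  obtain ⟨y, hy⟩ := isConj_iff.1 hj
  have hg' : gen a {i, j} = gen (fun l => g⁻¹ * b l * g) {i, j} := by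
    have := congrArg (conjBy g⁻¹) hg
    rw [conjBy_conjBy, inv_mul_cancel, conjBy_one, conjBy_gen] at this
    simpa using this
  -- Applying the retraction to the conjugation equations, whose results it fixes, moves the
  -- conjugators into the span.
  set r := ha.retract {i, j}
  set x' := r (g⁻¹ * x)
  set y' := r (g⁻¹ * y)
  have hx' : g⁻¹ * b i * g = x' * a i * x'⁻¹ := by
    have h1 : g⁻¹ * b i * g ∈ gen a {i, j} := hg' ▸ mem_gen (c := fun l => g⁻¹ * b l * g) (by simp)
    have h2 := ha.retract_eq_self h1
    rw [← hx, show g⁻¹ * (x * a i * x⁻¹) * g = (g⁻¹ * x) * a i * (g⁻¹ * x)⁻¹ by group,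
      map_mul, map_mul, map_inv, ha.retract_of_mem (by simp)] at h2
    rw [← hx, show g⁻¹ * (x * a i * x⁻¹) * g = (g⁻¹ * x) * a i * (g⁻¹ * x)⁻¹ by group, ← h2]
  have hy' : g⁻¹ * b j * g = y' * a j * y'⁻¹ := by
    have h1 : g⁻¹ * b j * g ∈ gen a {i, j} := hg' ▸ mem_gen (c := fun l => g⁻¹ * b l * g) (by simp)
    have h2 := ha.retract_eq_self h1
    rw [← hy, show g⁻¹ * (y * a j * y⁻¹) * g = (g⁻¹ * y) * a j * (g⁻¹ * y)⁻¹ by group,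
      map_mul, map_mul, map_inv, ha.retract_of_mem (by simp)] at h2
    rw [← hy, show g⁻¹ * (y * a j * y⁻¹) * g = (g⁻¹ * y) * a j * (g⁻¹ * y)⁻¹ by group, ← h2]
  have hxm : x' ∈ gen a {i, j} := ha.retract_mem _ _
  have hym : y' ∈ gen a {i, j} := ha.retract_mem _ _
  set p := x'⁻¹ * y'
  have hp : p ∈ gen a {i, j} := mul_mem (inv_mem hxm) hym
  have hmem : a j ∈ Subgroup.closure {a i, p * a j * p⁻¹} := by
    have h1 : x' * a j * x'⁻¹ ∈ gen (fun l => g⁻¹ * b l * g) {i, j} :=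
      hg' ▸ mul_mem (mul_mem hxm (mem_gen (by simp))) (inv_mem hxm)
    have h2 := map_mem_of_mem_gen h1 (MulAut.conj x'⁻¹).toMonoidHom
      (K := Subgroup.closure {a i, p * a j * p⁻¹}) (by
        rintro l (rfl | rfl)
        · apply Subgroup.subset_closure
          left
          change x'⁻¹ * (g⁻¹ * b l * g) * x'⁻¹⁻¹ = a l
          rw [hx']; group
        · apply Subgroup.subset_closure
          right
          change x'⁻¹ * (g⁻¹ * b l * g) * x'⁻¹⁻¹ = p * a l * p⁻¹
          rw [hy']; simp only [p]; group)
    have h3 : (MulAut.conj x'⁻¹).toMonoidHom (x' * a j * x'⁻¹) = a j := by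
      change x'⁻¹ * (x' * a j * x'⁻¹) * x'⁻¹⁻¹ = a j
      group
    rwa [h3] at h2
  obtain ⟨α, κ, hακ⟩ := ha.eq_zpow_mul_zpow_of_mem_closure hij hp hmem
  have hy'' : y' = x' * a i ^ α * a j ^ κ := by
    rw [mul_assoc, ← hακ, mul_inv_cancel_left]
  -- `x' (a i)^α` acts on `a i` as `x'` does, and on `a j` as `y'` does, since `(a j)^κ` centralises
  -- `a j`.
  refine ⟨g * (x' * a i ^ α), ?_, ?_⟩
  · have h1 : b i = g * (g⁻¹ * b i * g) * g⁻¹ := by group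
    rw [h1, hx']
    group
  · have h1 : b j = g * (g⁻¹ * b j * g) * g⁻¹ := by group
    rw [h1, hy', hy'']
    group

/-- Two bases whose members with index in `T` are conjugate, and whose subsets with indices in `T`
span conjugate subgroups, are simultaneously conjugate on `T`. -/
theorem exists_conj_of_conj_gen (ha : IsBasis a) (T : Finset ι) (hT : T.Nonempty)
    (hab : ∀ j ∈ T, IsConj (a j) (b j))
    (h : ∀ S ⊆ T, S.Nonempty → ∃ g, conjBy g (gen a (S : Set ι)) = gen b (S : Set ι)) :
    ∃ g, ∀ j ∈ T, b j = g * a j * g⁻¹ := by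
  classical
  induction hn : T.card using Nat.strong_induction_on generalizing T with
  | _ n ih =>
  subst hn
  have hpos := hT.card_pos
  obtain h1 | h2 | h3 : T.card = 1 ∨ T.card = 2 ∨ 2 < T.card := by omega
  · obtain ⟨j, rfl⟩ := Finset.card_eq_one.1 h1
    obtain ⟨g, hg⟩ := isConj_iff.1 (hab j (by simp))
    exact ⟨g, by simpa using hg.symm⟩
  · obtain ⟨i, j, hij, rfl⟩ := Finset.card_eq_two.1 h2
    obtain ⟨g, hg₁, hg₂⟩ := exists_conj_pair ha hij (hab i (by simp)) (hab j (by simp))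
      (by simpa using h _ subset_rfl hT)
    exact ⟨g, by simpa using ⟨hg₁, hg₂⟩⟩
  · obtain ⟨i, hi, j, hj, k, hk, hij, hik, hjk⟩ := Finset.two_lt_card.1 h3
    have hsub : ∀ m ∈ T, ∃ g, ∀ l ∈ T.erase m, b l = g * a l * g⁻¹ := fun m hm => by
      have hcard := Finset.card_erase_of_mem hm
      exact ih _ (by omega) (T.erase m) (Finset.card_pos.1 (by omega))
        (fun l hl => hab l (Finset.mem_of_mem_erase hl))
        (fun S hS => h S (hS.trans (Finset.erase_subset _ _))) rfl
    obtain ⟨x, hx⟩ := hsub i hi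
    obtain ⟨y, hy⟩ := hsub j hj
    obtain ⟨z, hz⟩ := hsub k hk
    have comm : ∀ {x y : G} {l : ι}, b l = x * a l * x⁻¹ → b l = y * a l * y⁻¹ →
        ∃ m : ℤ, y⁻¹ * x = a l ^ m := fun {x y l} h₁ h₂ => by
      apply ha.exists_eq_zpow_of_commute
      have h3 : x * a l = y * a l * y⁻¹ * x := by rw [← h₂, h₁]; group
      rw [mul_assoc, h3]; group
    obtain ⟨α, hα⟩ := comm (hx k (by simp [hk, hik.symm])) (hy k (by simp [hk, hjk.symm]))
    obtain ⟨β, hβ⟩ := comm (hy i (by simp [hi, hij])) (hz i (by simp [hi, hik]))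
    obtain ⟨γ, hγ⟩ := comm (hz j (by simp [hj, hjk])) (hx j (by simp [hj, hij.symm]))
    -- The product of `x⁻¹ z`, `z⁻¹ y` and `y⁻¹ x` telescopes; exponent sums then show that each
    -- power is trivial.
    have hprod : a j ^ γ * a i ^ β * a k ^ α = 1 := by
      rw [← hα, ← hβ, ← hγ]; group
    have hα0 : α = 0 := by
      apply ha.expo_zpow_eq_one (j := k)
      have := congrArg (ha.expo k) hprod
      rwa [map_mul, map_mul, map_zpow, map_zpow _ (a i), ha.expo_of_ne hjk, ha.expo_of_ne hik,
        one_zpow, one_zpow, one_mul, one_mul, map_one] at this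
    have hxy : x = y := by
      rw [hα0, zpow_zero, inv_mul_eq_one] at hα
      exact hα.symm
    refine ⟨x, fun l hl => ?_⟩
    by_cases hli : l = i
    · rw [hli, hxy]; exact hy i (by simp [hi, hij])
    · exact hx l (by simp [hl, hli])

/-- Two bases that agree outside `{z, i}` can be merged if there is a common complement, up to
conjugacy, of the span of the first without `z` and of the second without `i`. -/
theorem IsBasis.merge [DecidableEq ι] (ha : IsBasis a) (hb : IsBasis b) {z i : ι} (hzi : z ≠ i)
    (hagree : ∀ l, l ≠ z → l ≠ i → a l = b l) (hz : IsConj (a z) (b z)) (hi : IsConj (a i) (b i))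
    {u : G} (hu : u ∈ gen a {z}ᶜ)
    (hub : ∃ h, Subgroup.closure (insert (h * u * h⁻¹) (b '' {i}ᶜ)) = ⊤)
    (hne : ∀ t, (t = a i ∨ t = (a i)⁻¹) → ¬ IsConj t u) :
    IsBasis (Function.update a z (b z)) := by
  obtain ⟨h, hh⟩ := hub
  obtain ⟨g, hg⟩ := isConj_iff.1 hi
  set r := ha.retract {z}ᶜ
  have hra : ∀ l, l ≠ z → r (a l) = a l := fun l hl => ha.retract_of_mem hl
  have hrbz : r (b z) = 1 := by
    obtain ⟨y, hy⟩ := isConj_iff.1 hz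
    rw [← hy, map_mul, map_mul, ha.retract_of_notMem (by simp), mul_one, map_inv, mul_inv_cancel]
  have hru : r u = u := ha.retract_eq_self hu
  -- `u` is conjugate to `a i ^ {±1} * v` with `v` in the span of the common basis elements
  have htop : Subgroup.closure (insert (r h * u * (r h)⁻¹) (a '' {i}ᶜ)) = ⊤ := by
    rw [eq_top_iff, ← ha.gen_univ, gen_le]
    intro l _
    by_cases hlz : l = z
    · have hli : l ∈ ({i}ᶜ : Set ι) := by rw [hlz]; exact hzi
      exact Subgroup.subset_closure (Or.inr ⟨l, hli, rfl⟩)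
    · rw [← hra l hlz]
      have hmem : a l ∈ Subgroup.closure (insert (h * u * h⁻¹) (b '' {i}ᶜ)) :=
        hh ▸ Subgroup.mem_top _
      have hle : Subgroup.closure (insert (h * u * h⁻¹) (b '' {i}ᶜ)) ≤
          (Subgroup.closure (insert (r h * u * (r h)⁻¹) (a '' {i}ᶜ))).comap r := by
        rw [Subgroup.closure_le, Set.insert_subset_iff]
        constructor
        · apply Subgroup.subset_closure
          left
          rw [map_mul, map_mul, map_inv, hru]
        · rintro _ ⟨m, hm, rfl⟩
          rw [SetLike.mem_coe, Subgroup.mem_comap]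
          by_cases hmz : m = z
          · rw [hmz, hrbz]; exact one_mem _
          · rw [← hagree m hmz hm, hra m hmz]
            exact Subgroup.subset_closure (Or.inr ⟨m, hm, rfl⟩)
      exact hle hmem
  obtain ⟨γ, hγ, δ, hδ, t, ht, hs⟩ := ha.eq_mul_of_mul_of_closure_eq_top htop
  have hrt : r t = t := by
    rcases ht with rfl | rfl
    · exact hra i hzi.symm
    · rw [map_inv, hra i hzi.symm]
  -- A second application of `r` removes `a z` from the conjugator and from `γ` and `δ`, so that
  -- what remains is expressed by basis elements common to `a` and `b`, apart from `a i`.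
  have hs' : r (r h) * u * (r (r h))⁻¹ = r γ * t * r δ := by
    have := congrArg r hs
    rwa [map_mul, map_mul, map_inv, hru, map_mul, map_mul, hrt] at this
  have hrab : ∀ x ∈ gen a {i}ᶜ, r x ∈ gen b {i}ᶜ := fun x hx =>
    map_mem_of_mem_gen hx r fun l hl => by
      by_cases hlz : l = z
      · rw [hlz, ha.retract_of_notMem (by simp)]; exact one_mem _
      · rw [hra l hlz, hagree l hlz hl]; exact mem_gen hl
  set v := r δ * r γ
  have hv : v ∈ gen b {i}ᶜ := mul_mem (hrab δ hδ) (hrab γ hγ)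
  have huv : IsConj (t * v) u := by
    refine isConj_iff.2 ⟨(r (r h))⁻¹ * r γ, ?_⟩
    calc (r (r h))⁻¹ * r γ * (t * v) * ((r (r h))⁻¹ * r γ)⁻¹
        = (r (r h))⁻¹ * (r γ * t * r δ) * r (r h) := by simp only [v]; group
      _ = u := by rw [← hs']; group
  -- Otherwise `u` would be conjugate to `(a i)^{±1}`, and `u` would carry no information on the
  -- conjugator `g` relating `a i` and `b i`.
  have hv1 : v ≠ 1 := by
    intro hv1
    rw [hv1, mul_one] at huv
    exact hne t ht huv
  obtain ⟨γ', hγ', δ', hδ', t', ht', hs''⟩ := hb.eq_mul_of_mul_of_closure_eq_top hh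
  have htb : ∃ tb, (tb = b i ∨ tb = (b i)⁻¹) ∧ t = g⁻¹ * tb * g := by
    rcases ht with rfl | rfl
    · exact ⟨b i, Or.inl rfl, by rw [← hg]; group⟩
    · exact ⟨(b i)⁻¹, Or.inr rfl, by rw [← hg]; group⟩
  obtain ⟨tb, htb, htg⟩ := htb
  have hconj : IsConj (g⁻¹ * tb * g * v) (γ' * t' * δ') := by
    rw [← htg, ← hs'']
    exact huv.trans (isConj_iff.2 ⟨h, rfl⟩)
  obtain ⟨k, hk⟩ := hb.exists_zpow_mul_mem_of_isConj hv hv1 hγ' hδ' htb ht' hconj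
  have hai : a i = (b i ^ k * g)⁻¹ * b i * (b i ^ k * g) := by
    have : a i = g⁻¹ * b i * g := by rw [← hg]; group
    rw [this]; group
  -- Up to a power of `b i`, which does not matter, `g` lies in the span of the other members of
  -- `b`. So `a i` may replace `b i` in `b`, and the result is `a` with `b z` in place of `a z`.
  have hres := hb.update (inv_mem hk) hk (Or.inl rfl)
  rw [← hai] at hres
  convert hres using 1
  funext l
  by_cases hlz : l = z
  · subst hlz
    rw [Function.update_self, Function.update_of_ne hzi]
  · rw [Function.update_of_ne hlz]
    by_cases hli : l = i
    · subst hli; rw [Function.update_self]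
    · rw [Function.update_of_ne hli, hagree l hlz hli]

end FreeFactors

namespace FreeFactors

variable {ι G : Type*} [Group G]

/-! ### Gluing bases of the faces -/

theorem closure_insert_conj_eq_top {c : ι → G} {s : G} {T : Set ι}
    (h : Subgroup.closure (insert s (c '' T)) = ⊤) (y : G) :
    Subgroup.closure (insert (y * s * y⁻¹) ((fun l => y * c l * y⁻¹) '' T)) = ⊤ := by
  have h1 := congrArg (Subgroup.map (MulAut.conj y).toMonoidHom) h
  rw [MonoidHom.map_closure, Subgroup.map_top_of_surjective _ (MulAut.conj y).surjective,
    Set.image_insert_eq, Set.image_image] at h1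
  exact h1

section
variable [DecidableEq ι] {b : ι → ι → G}

/-- `IsBasis.merge` for conjugates of two face bases. The third index `j` serves to show that `u` is
not conjugate to a generator of the vertex `i` or its inverse. -/
theorem merge_faces {z i j : ι} (hb : ∀ m, IsBasis (b m))
    (hbc : ∀ m k l, IsConj (b m l) (b k l)) (hzi : z ≠ i) (hjz : j ≠ z) (hji : j ≠ i)
    (hu : ∃ u ∈ gen (b z) {z}ᶜ, ∀ l, l ≠ z →
      ∃ h, Subgroup.closure (insert (h * u * h⁻¹) (b l '' {l}ᶜ)) = ⊤)
    {x y : G} (hxy : ∀ l, l ≠ z → l ≠ i → x * b z l * x⁻¹ = y * b i l * y⁻¹) :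
    IsBasis (Function.update (fun l => x * b z l * x⁻¹) z (y * b i z * y⁻¹)) := by
  obtain ⟨u, hu, hut⟩ := hu
  have hcc : ∀ l, IsConj (x * b z l * x⁻¹) (y * b i l * y⁻¹) := fun l =>
    ((isConj_iff.2 ⟨x, rfl⟩ : IsConj (b z l) _).symm.trans (hbc z i l)).trans
      (isConj_iff.2 ⟨y, rfl⟩)
  refine ((hb z).conj x).merge ((hb i).conj y) hzi hxy (hcc z) (hcc i) (u := x * u * x⁻¹) ?_ ?_ ?_
  · rw [← conjBy_gen, mem_conjBy]
    simpa [mul_assoc] using hu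
  · obtain ⟨h, hh⟩ := hut i hzi.symm
    refine ⟨y * h * x⁻¹, ?_⟩
    have := closure_insert_conj_eq_top hh y
    rwa [show y * (h * u * h⁻¹) * y⁻¹ = y * h * x⁻¹ * (x * u * x⁻¹) * (y * h * x⁻¹)⁻¹ by group]
      at this
  -- If it were, its exponent sum in `j` would vanish, and `u` together with the members of `b j`
  -- other than `b j j` would lie in the kernel of that exponent sum.
  · intro t ht htu
    have hexp : (hb z).expo j u = 1 := by
      rw [← (hb z).expo_conj j x u, ← (hb z).expo_eq_of_isConj j htu]
      rcases ht with rfl | rfl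
      · rw [(hb z).expo_conj, (hb z).expo_of_ne hji.symm]
      · rw [map_inv, (hb z).expo_conj, (hb z).expo_of_ne hji.symm, inv_one]
    obtain ⟨h, hh⟩ := hut j hjz
    have hle : Subgroup.closure (insert (h * u * h⁻¹) (b j '' {j}ᶜ)) ≤ ((hb z).expo j).ker := by
      rw [Subgroup.closure_le, Set.insert_subset_iff]
      constructor
      · rw [SetLike.mem_coe, MonoidHom.mem_ker, (hb z).expo_conj, hexp]
      · rintro _ ⟨l, hl, rfl⟩
        rw [SetLike.mem_coe, MonoidHom.mem_ker, (hb z).expo_eq_of_isConj j (hbc j z l),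
          (hb z).expo_of_ne hl]
    have := hle (hh ▸ Subgroup.mem_top (b z j))
    rw [MonoidHom.mem_ker, (hb z).expo_self] at this
    simp at this

/-- For three indices two faces share one vertex, so their relative conjugator is free up to a
centraliser. Matching `b i` and `b j` with `b z` gives candidates `dᵢ` and `dⱼ` for the member `z`.
The merges with `b z` give `dⱼ = p dᵢ p⁻¹` with `p` in the span of the other two members, and the
merge of `b i` with `b j` splits `p` as a product of their powers. -/
theorem exists_glue_of_three {z i j : ι} (hb : ∀ m, IsBasis (b m))
    (hbc : ∀ m k l, IsConj (b m l) (b k l)) (hzi : z ≠ i) (hzj : z ≠ j) (hij : i ≠ j)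
    (huniv : ∀ l, l = z ∨ l = i ∨ l = j)
    (hu : ∀ m, ∃ u ∈ gen (b m) {m}ᶜ, ∀ l, l ≠ m →
      ∃ h, Subgroup.closure (insert (h * u * h⁻¹) (b l '' {l}ᶜ)) = ⊤) {x y : G}
    (hx : b z j = x * b i j * x⁻¹) (hy : b z i = y * b j i * y⁻¹) :
    ∃ c : ι → G, IsBasis c ∧ ∀ m, ∃ g, ∀ l, l ≠ m → c l = g * b m l * g⁻¹ := by
  set dᵢ := x * b i z * x⁻¹ with hdi
  set dⱼ := y * b j z * y⁻¹ with hdj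
  set β := Function.update (b z) z dᵢ with hβdef
  have hβ : IsBasis β := by
    have := merge_faces hb hbc hzi hzj.symm hij.symm (hu z) (x := 1) (y := x) (by
      intro l hlz hli
      obtain rfl : l = j := by have := huniv l; tauto
      simpa using hx)
    simpa using this
  have hβ' : IsBasis (Function.update (b z) z dⱼ) := by
    have := merge_faces hb hbc hzj hzi.symm hij (hu z) (x := 1) (y := y) (by
      intro l hlz hlj
      obtain rfl : l = i := by have := huniv l; tauto
      simpa using hy)
    simpa using this
  have hβz : β z = dᵢ := by simp [hβdef]
  have hβi : β i = b z i := by simp [hβdef, hzi.symm]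
  have hβj : β j = b z j := by simp [hβdef, hzj.symm]
  obtain ⟨q, hq⟩ : ∃ q, dⱼ = q * β z * q⁻¹ := by
    obtain ⟨w, hw⟩ := isConj_iff.1 (hbc i j z)
    refine ⟨y * w * x⁻¹, ?_⟩
    rw [hβz, hdi, hdj, ← hw]; group
  obtain ⟨p, hp, hqp⟩ := hβ.exists_conj_eq_of_closure_eq_top (i := z) (y := q) (by
    rw [← hq, eq_top_iff, ← hβ'.gen_univ, gen_le]
    intro l _
    by_cases hl : l = z
    · rw [hl, Function.update_self]; exact Subgroup.subset_closure (Or.inl rfl)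
    · rw [Function.update_of_ne hl]
      exact Subgroup.subset_closure (Or.inr ⟨l, hl, by rw [hβdef, Function.update_of_ne hl]⟩))
  rw [← hq, hβz] at hqp
  have hp' : p ∈ gen β {i, j} := by
    refine gen_mono ?_ hp
    intro l hl
    have hl : l ≠ z := hl
    have := huniv l
    simp; tauto
  -- Conjugation by `y` and by `p x` makes `b j` and `b i` agree at `z`, with common value `dⱼ`.
  have hβ'' := merge_faces hb hbc hij.symm hzj hzi (hu j) (x := y) (y := p * x) (by
      intro l hlj hli
      obtain rfl : l = z := by have := huniv l; tauto
      rw [← hdj, hqp, hdi]; group)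
  -- The retraction that kills `β z` also kills its conjugate `dⱼ`, and sends the other two members
  -- of the merged basis to `β i` and `p (β j) p⁻¹`.
  have hmem : β j ∈ Subgroup.closure {β i, p * β j * p⁻¹} := by
    have hr : hβ.retract {i, j} (β j) = β j := hβ.retract_of_mem (by simp)
    have htop := hβ''.gen_univ ▸ Subgroup.mem_top (β j)
    have hrz : hβ.retract {i, j} dᵢ = 1 := by
      rw [← hβz]; exact hβ.retract_of_notMem (by simp [hzi, hzj])
    rw [← hr]
    refine map_mem_of_mem_gen htop _ ?_
    intro l _
    rcases huniv l with rfl | rfl | rfl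
    · rw [Function.update_of_ne hzj, ← hdj, hqp, map_mul, map_mul, hrz, mul_one, map_inv,
        mul_inv_cancel]
      exact one_mem _
    · rw [Function.update_of_ne hij, ← hy, ← hβi]
      have h1 : hβ.retract {l, j} (β l) = β l := hβ.retract_of_mem (by simp)
      rw [h1]
      exact Subgroup.subset_closure (Or.inl rfl)
    · rw [Function.update_self]
      have : p * x * b i l * (p * x)⁻¹ = p * β l * p⁻¹ := by rw [hβj, hx]; group
      rw [this, map_mul, map_mul, map_inv, hβ.retract_eq_self hp', hr]
      exact Subgroup.subset_closure (Or.inr rfl)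
  obtain ⟨α, κ, hακ⟩ := hβ.eq_zpow_mul_zpow_of_mem_closure hij hp' hmem
  rw [hβi, hβj] at hακ
  have hκ : b z j ^ κ ∈ gen β {z}ᶜ := by
    rw [← hβj]; exact zpow_mem (mem_gen hzj.symm) κ
  -- With `p = (β i)^α (β j)^κ`, the conjugate of `dᵢ` by `(β j)^κ` equals that of `dⱼ` by `(β
  -- i)^{-α}`. Either power centralises the member that the respective face shares with `b z`.
  have hc := hβ.update hκ (inv_mem hκ) (Or.inl rfl)
  refine ⟨_, hc, fun m => ?_⟩
  rw [hβz]
  rcases huniv m with rfl | rfl | rfl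
  · refine ⟨1, fun l hl => ?_⟩
    rw [Function.update_of_ne hl, hβdef, Function.update_of_ne hl]; group
  · refine ⟨b z j ^ κ * x, fun l hl => ?_⟩
    rcases huniv l with rfl | rfl | rfl
    · rw [Function.update_self, hdi]; group
    · exact absurd rfl hl
    · rw [Function.update_of_ne hzj.symm, hβj]
      have h1 : b z l = b z l ^ κ * b z l * (b z l ^ κ)⁻¹ := by group
      refine h1.trans ?_
      nth_rewrite 2 [hx]
      group
  · refine ⟨(b z i ^ α)⁻¹ * y, fun l hl => ?_⟩
    rcases huniv l with rfl | rfl | rfl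
    · rw [Function.update_self]
      have h1 : (b l i ^ α)⁻¹ * y * b m l * ((b l i ^ α)⁻¹ * y)⁻¹ =
          (b l i ^ α)⁻¹ * dⱼ * b l i ^ α := by rw [hdj]; group
      rw [h1, hqp, hακ]; group
    · rw [Function.update_of_ne hzi.symm, hβi]
      have h1 : b z l = (b z l ^ α)⁻¹ * b z l * b z l ^ α := by group
      refine h1.trans ?_
      nth_rewrite 2 [hy]
      group
    · exact absurd rfl hl

/-- Each face basis, conjugated to agree with `b z`, proposes a member `d m` for the index `z`. All
proposals coincide because the conjugators between them are powers of members of `b z` that must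
cancel around a triangle of indices; a fourth index makes the triangle available. -/
theorem exists_glue_of_four {z : ι} (hb : ∀ m, IsBasis (b m))
    (hbc : ∀ m k l, IsConj (b m l) (b k l)) {i₀ : ι} (hi₀ : i₀ ≠ z)
    (hthird : ∀ i j, ∃ k, k ≠ z ∧ k ≠ i ∧ k ≠ j)
    (hface : ∀ m k, ∃ g, ∀ l, l ≠ m → l ≠ k → b k l = g * b m l * g⁻¹)
    (hu : ∀ m, ∃ u ∈ gen (b m) {m}ᶜ, ∀ l, l ≠ m →
      ∃ h, Subgroup.closure (insert (h * u * h⁻¹) (b l '' {l}ᶜ)) = ⊤) :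
    ∃ c : ι → G, IsBasis c ∧ ∀ m, ∃ g, ∀ l, l ≠ m → c l = g * b m l * g⁻¹ := by
  choose g hg using fun m => hface m z
  set d := fun m => g m * b m z * (g m)⁻¹ with hd
  have hβ : ∀ i, i ≠ z → IsBasis (Function.update (b z) z (d i)) := fun i hi => by
    obtain ⟨j, hjz, hji, -⟩ := hthird i i
    have := merge_faces hb hbc hi.symm hjz hji (hu z) (x := 1) (y := g i) (by
      intro l hlz hli
      simpa using hg i l hli hlz)
    simpa using this
  have hexpd : ∀ i k, k ≠ z → (hb z).expo k (d i) = 1 := fun i k hk => by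
    rw [hd]
    dsimp only
    rw [(hb z).expo_conj, (hb z).expo_eq_of_isConj k (hbc i z z), (hb z).expo_of_ne hk.symm]
  -- The conjugator centralises every member of `b z` that the faces `z`, `i` and `j` share, so it
  -- is a power of each of them.
  have hpair : ∀ i j, i ≠ z → j ≠ z →
      ∃ x, (∀ l, l ≠ z → l ≠ i → l ≠ j → ∃ m : ℤ, x = b z l ^ m) ∧ d j = x * d i * x⁻¹ := by
    intro i j hi hj
    obtain ⟨h, hh⟩ := hface i j
    refine ⟨g j * h * (g i)⁻¹, fun l hlz hli hlj => ?_, ?_⟩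
    · apply (hb z).exists_eq_zpow_of_commute
      nth_rewrite 1 [hg i l hli hlz]
      rw [hg j l hlj hlz, hh l hli hlj]
      group
    · simp only [hd]
      rw [hh z hi.symm hj.symm]
      group
  have hdeq : ∀ i j, i ≠ z → j ≠ z → d i = d j := by
    intro i j hi hj
    by_cases hij : i = j
    · rw [hij]
    obtain ⟨k, hkz, hki, hkj⟩ := hthird i j
    obtain ⟨x₁, hx₁, hd₁⟩ := hpair i j hi hj
    obtain ⟨x₂, hx₂, hd₂⟩ := hpair j k hj hkz
    obtain ⟨x₃, hx₃, hd₃⟩ := hpair k i hkz hi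
    obtain ⟨α, rfl⟩ := hx₁ k hkz hki hkj
    obtain ⟨β, rfl⟩ := hx₂ i hi hij hki.symm
    obtain ⟨γ, rfl⟩ := hx₃ j hj hkj.symm (Ne.symm hij)
    -- Going around the triangle `i`, `j`, `k` returns to `d i`, so the product of the three powers
    -- centralises `d i`. As `d i` belongs to a basis, the product is a power of it, and so has
    -- exponent sum zero in `k`.
    obtain ⟨s, hs⟩ := (hβ i hi).exists_eq_zpow_of_commute (i := z)
      (x := b z j ^ γ * b z i ^ β * b z k ^ α) (by
        rw [Function.update_self]
        nth_rewrite 2 [hd₃]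
        rw [hd₂, hd₁]
        group)
    rw [Function.update_self] at hs
    have hα : α = 0 := by
      apply (hb z).expo_zpow_eq_one (j := k)
      have := congrArg ((hb z).expo k) hs
      rwa [map_mul, map_mul, map_zpow, map_zpow _ (b z i), map_zpow _ (d i), hexpd i k hkz,
        (hb z).expo_of_ne hkj.symm, (hb z).expo_of_ne hki.symm, one_zpow, one_zpow, one_zpow,
        one_mul, one_mul] at this
    rw [hd₁, hα]
    simp
  refine ⟨_, hβ i₀ hi₀, fun m => ?_⟩
  by_cases hm : m = z
  · subst hm
    exact ⟨1, fun l hl => by rw [Function.update_of_ne hl]; simp⟩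
  · refine ⟨g m, fun l hl => ?_⟩
    by_cases hlz : l = z
    · rw [hlz, Function.update_self, hdeq i₀ m hi₀ hm]
    · rw [Function.update_of_ne hlz]
      exact hg m l hl hlz

/-- A family of bases, one for each face of the boundary of a simplex, whose partial spans agree up
to conjugacy on common faces comes from one basis if each face has, up to conjugacy, an element that
is complementary to all other faces. -/
theorem exists_glue [Fintype ι] (hι : 3 ≤ Fintype.card ι) (hb : ∀ m, IsBasis (b m))
    (hbc : ∀ m k l, IsConj (b m l) (b k l))
    (hface : ∀ m k, ∀ S : Finset ι, S.Nonempty → m ∉ S → k ∉ S →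
      ∃ g, conjBy g (gen (b m) (S : Set ι)) = gen (b k) (S : Set ι))
    (hu : ∀ m, ∃ u ∈ gen (b m) {m}ᶜ, ∀ l, l ≠ m →
      ∃ h, Subgroup.closure (insert (h * u * h⁻¹) (b l '' {l}ᶜ)) = ⊤) :
    ∃ c : ι → G, IsBasis c ∧ ∀ m, ∃ g, ∀ l, l ≠ m → c l = g * b m l * g⁻¹ := by
  obtain hι | hι : Fintype.card ι = 3 ∨ 4 ≤ Fintype.card ι := by omega
  · obtain ⟨z, i, j, hzi, hzj, hij, huniv⟩ := Finset.card_eq_three.1 hι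
    obtain ⟨x, hx⟩ := isConj_iff.1 (hbc i z j)
    obtain ⟨y, hy⟩ := isConj_iff.1 (hbc j z i)
    refine exists_glue_of_three hb hbc hzi hzj hij (fun l => ?_) hu hx.symm hy.symm
    have := Finset.mem_univ l
    rwa [huniv, Finset.mem_insert, Finset.mem_insert, Finset.mem_singleton] at this
  · have hex : ∀ T : Finset ι, T.card ≤ 3 → ∃ k, k ∉ T := fun T hT => by
      by_contra! hcon
      rw [← Finset.card_univ, ← Finset.eq_univ_iff_forall.2 hcon] at hι
      omega
    obtain ⟨z, -⟩ := hex ∅ (by simp)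
    obtain ⟨i₀, hi₀⟩ := hex {z} (by simp)
    refine exists_glue_of_four (z := z) (i₀ := i₀) hb hbc (by simpa using hi₀) ?_ ?_ hu
    · intro i j
      obtain ⟨k, hk⟩ := hex {z, i, j} Finset.card_le_three
      exact ⟨k, by simpa using hk⟩
    · intro m k
      obtain ⟨l, hl⟩ := hex {m, k} (Finset.card_le_two.trans (by simp))
      obtain ⟨g, hg⟩ := exists_conj_of_conj_gen (b := b k) (hb m) {m, k}ᶜ
        ⟨l, by simpa using hl⟩ (fun j _ => hbc m k j) (fun S hS hne => hface m k S hne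
          (fun h => by simpa using hS h) (fun h => by simpa using hS h))
      exact ⟨g, fun l hlm hlk => hg l (by simp [hlm, hlk])⟩

end

end FreeFactors

namespace FreeFactors

/-! ### Standard vertices of the complexes of free factors -/

theorem cls_eq_cls_iff {n : ℕ} {A B : AF n} : cls A = cls B ↔ ∃ g, B.1 = conjBy g A.1 := by
  rw [cls_eq_iff]
  exact exists_congr fun g => Subtype.ext_iff

theorem gen_eq_of_eq_or_eq_inv {ι G : Type*} [Group G] {c d : ι → G} {S : Set ι}
    (h : ∀ i ∈ S, d i = c i ∨ d i = (c i)⁻¹) : gen d S = gen c S := by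
  apply le_antisymm
  · rw [gen_le]
    intro i hi
    rcases h i hi with h | h
    · rw [h]; exact mem_gen hi
    · rw [h]; exact inv_mem (mem_gen hi)
  · rw [gen_le]
    intro i hi
    rcases h i hi with h | h
    · rw [← h]; exact mem_gen hi
    · rw [← inv_inv (c i), ← h]; exact inv_mem (mem_gen hi)

variable {n : ℕ} {c d : Fin n → FreeGroup (Fin n)}

/-- The vertex of `AF_n` spanned by a non-empty proper subset of a basis. -/
def IsBasis.factor (hc : IsBasis c) (S : BdryVertex n) : AF n :=
  ⟨gen c S.1, ⟨_, hc.isFreeProduct_gen _⟩, by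
    obtain ⟨i, hi⟩ := S.2.1
    intro h
    have h1 : c i ∈ gen c (S.1 : Set (Fin n)) := mem_gen hi
    rw [h, Subgroup.mem_bot] at h1
    have h2 := hc.expo_self i
    rw [h1, map_one, eq_comm] at h2
    simp at h2, by
    intro h
    refine S.2.2 (Finset.eq_univ_iff_forall.2 fun i => ?_)
    have h1 : c i ∈ gen c (S.1 : Set (Fin n)) := h ▸ Subgroup.mem_top _
    exact hc.mem_gen_iff.1 h1⟩

/-- The vertex of `OF_n` spanned by a non-empty proper subset of a basis. -/
def IsBasis.factorClass (hc : IsBasis c) (S : BdryVertex n) : OF n := cls (hc.factor S)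

/-- Exponent sums are invariant under conjugation, so a member outside `T` has no conjugate in a
conjugate of the span of `T`. -/
theorem IsBasis.factorClass_le_iff (hc : IsBasis c) {S T : BdryVertex n} :
    hc.factorClass S ≤ hc.factorClass T ↔ S ≤ T := by
  constructor
  · rintro ⟨A, B, hA, hB, hAB⟩
    obtain ⟨g, hg⟩ := cls_eq_cls_iff.1 hA.symm
    obtain ⟨h, hh⟩ := cls_eq_cls_iff.1 hB.symm
    intro i hi
    by_contra hiT
    have h1 : g * c i * g⁻¹ ∈ A.1 := by
      rw [hg, mem_conjBy]
      have : g⁻¹ * (g * c i * g⁻¹) * g = c i := by group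
      rw [this]
      exact mem_gen (c := c) (S := (S.1 : Set (Fin n))) hi
    have h2 : g * c i * g⁻¹ ∈ B.1 := hAB h1
    rw [hh, mem_conjBy] at h2
    have h3 := hc.expo_eq_one_of_mem (S := (T.1 : Set (Fin n))) (j := i) hiT h2
    rw [show h⁻¹ * (g * c i * g⁻¹) * h = (h⁻¹ * g) * c i * (h⁻¹ * g)⁻¹ by group,
      hc.expo_conj, hc.expo_self] at h3
    simp at h3
  · intro h
    exact ⟨hc.factor S, hc.factor T, rfl, rfl, gen_mono (c := c) (Finset.coe_subset.2 h)⟩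

theorem IsBasis.hasRank_factorClass (hc : IsBasis c) (S : BdryVertex n) :
    HasRank (hc.factorClass S) S.1.card :=
  ⟨hc.factor S, rfl, ⟨(hc.freeGroupBasisGen (S.1 : Set (Fin n))).reindex S.1.equivFin⟩⟩

theorem IsBasis.eq_card_of_hasRank (hc : IsBasis c) {S : BdryVertex n} {k : ℕ}
    (h : HasRank (hc.factorClass S) k) : k = S.1.card := by
  obtain ⟨A, hA, ⟨e⟩⟩ := h
  obtain ⟨g, hg⟩ := cls_eq_cls_iff.1 hA.symm
  have hg' : A.1 = gen (fun i => g * c i * g⁻¹) (S.1 : Set (Fin n)) := hg.trans (conjBy_gen _ _)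
  have e' := (hc.conj g).freeGroupBasisGen (S.1 : Set (Fin n))
  have e'' := e.repr.symm.trans ((MulEquiv.subgroupCongr hg').trans e'.repr)
  have := Fintype.card_congr (Equiv.ofFreeGroupEquiv e'')
  simpa using this

/-- Classes of the spans of a set of subsets of a basis form the image of the full subcomplex of
`AF_n` spanned by them. -/
theorem IsBasis.imageComplex_eq (hc : IsBasis c) {σ : BdryVertex n → OF n}
    {X : Set (BdryVertex n)} (hσ : ∀ S ∈ X, σ S = hc.factorClass S) :
    imageComplex σ (fullSubcomplex (orderComplex (BdryVertex n)) X) =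
      imageComplex cls (fullSubcomplex (orderComplex (AF n))
        {A | ∃ S ∈ X, A.1 = Subgroup.closure (c '' (S.1 : Set (Fin n)))}) := by
  classical
  have hmono : ∀ S T : BdryVertex n, S ≤ T → hc.factor S ≤ hc.factor T := fun S T h =>
    gen_mono (c := c) (Finset.coe_subset.2 h)
  have hmono' : ∀ S T : BdryVertex n, hc.factor S ≤ hc.factor T → S ≤ T := fun S T h =>
    hc.factorClass_le_iff.1 ⟨_, _, rfl, rfl, h⟩
  apply PreAbstractSimplicialComplex.ext
  ext s
  constructor
  · rintro ⟨s, ⟨⟨hne, hch⟩, hX⟩, rfl⟩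
    refine ⟨s.image hc.factor, ⟨⟨hne.image _, ?_⟩, ?_⟩, ?_⟩
    · rw [Finset.coe_image]
      rintro _ ⟨S, hS, rfl⟩ _ ⟨T, hT, rfl⟩ hST
      exact (hch hS hT (by rintro rfl; exact hST rfl)).imp (hmono _ _) (hmono _ _)
    · rw [Finset.coe_image]
      rintro _ ⟨S, hS, rfl⟩
      exact ⟨S, hX hS, rfl⟩
    · ext v
      simp only [Finset.mem_image, exists_exists_and_eq_and]
      exact exists_congr fun S => and_congr_right fun hS => by rw [hσ S (hX hS)]; rfl
  · rintro ⟨s, ⟨⟨hne, hch⟩, hX⟩, rfl⟩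
    obtain ⟨A₀, hA₀⟩ := hne
    have : Nonempty (BdryVertex n) := ⟨(hX hA₀).choose⟩
    have hne : s.Nonempty := ⟨A₀, hA₀⟩
    have hX' : ∀ A ∈ s, ∃ S ∈ X, A.1 = Subgroup.closure (c '' (S.1 : Set (Fin n))) :=
      fun A hA => hX hA
    choose! f hf using hX'
    have hf' : ∀ A ∈ s, hc.factor (f A) = A := fun A hA => Subtype.ext (hf A hA).2.symm
    refine ⟨s.image f, ⟨⟨hne.image _, ?_⟩, ?_⟩, ?_⟩
    · rw [Finset.coe_image]
      rintro _ ⟨A, hA, rfl⟩ _ ⟨B, hB, rfl⟩ hAB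
      have := hch hA hB (by rintro rfl; exact hAB rfl)
      rw [← hf' A hA, ← hf' B hB] at this
      exact this.imp (hmono' _ _) (hmono' _ _)
    · rw [Finset.coe_image]
      rintro _ ⟨A, hA, rfl⟩
      exact (hf A hA).1
    · ext v
      simp only [Finset.mem_image, exists_exists_and_eq_and]
      exact exists_congr fun A => and_congr_right fun hA => by
        rw [hσ _ (hf A hA).1, IsBasis.factorClass, hf' A hA]

/-- Equality of complexes is used only on one-point simplices, that is, on vertices. -/
theorem IsBasis.exists_eq_factorClass (hc : IsBasis c) {σ : BdryVertex n → OF n}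
    {X Y : Set (BdryVertex n)}
    (h : imageComplex σ (fullSubcomplex (orderComplex (BdryVertex n)) X) =
      imageComplex cls (fullSubcomplex (orderComplex (AF n))
        {A | ∃ S ∈ Y, A.1 = Subgroup.closure (c '' (S.1 : Set (Fin n)))}))
    {S : BdryVertex n} (hS : S ∈ X) : ∃ S', σ S = hc.factorClass S' := by
  classical
  have h1 : ({σ S} : Finset (OF n)) ∈
      (imageComplex σ (fullSubcomplex (orderComplex (BdryVertex n)) X)).faces :=
    ⟨{S}, ⟨⟨Finset.singleton_nonempty _, by simp⟩, by simpa using hS⟩, by simp⟩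
  rw [h] at h1
  obtain ⟨s, ⟨-, hs⟩, hsS⟩ := h1
  have h2 : σ S ∈ s.image cls := by
    have : s.image cls = {σ S} := by convert hsS
    rw [this]; simp
  obtain ⟨A, hA, hAS⟩ := Finset.mem_image.1 h2
  obtain ⟨S', -, hS'⟩ := hs hA
  refine ⟨S', hAS.symm.trans (congrArg cls (Subtype.ext hS'))⟩

theorem fullSubcomplex_univ {V : Type*} (K : PreAbstractSimplicialComplex V) :
    fullSubcomplex K Set.univ = K := by
  apply PreAbstractSimplicialComplex.ext
  ext s
  simp [fullSubcomplex]

/-- A permutation of a basis matches an apartment with the standard apartment on a face. -/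
theorem IsBasis.exists_factorClass_eq (hn : 3 ≤ n) (hc : IsBasis c) {σ : BdryVertex n → OF n}
    (hσ : IsApartmentMap σ) (T : Finset (Fin n))
    (h : ∀ S : BdryVertex n, S.1 ⊆ T → ∃ S', σ S = hc.factorClass S') :
    ∃ (d : Fin n → FreeGroup (Fin n)) (hd : IsBasis d),
      ∀ S : BdryVertex n, S.1 ⊆ T → σ S = hd.factorClass S := by
  classical
  choose! τ hτ using h
  have hcard : ∀ S : BdryVertex n, S.1 ⊆ T → (τ S).1.card = S.1.card := fun S hS =>
    (hc.eq_card_of_hasRank (hτ S hS ▸ hσ.rank S)).symm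
  -- Simpliciality gives only comparability of the images; ranks decide the direction.
  have hmono : ∀ S S' : BdryVertex n, S.1 ⊆ T → S'.1 ⊆ T → S ≤ S' → τ S ≤ τ S' := by
    intro S S' hS hS' hSS'
    have h1 : ({σ S, σ S'} : Finset (OF n)) ∈ (orderComplex (OF n)).faces := by
      apply hσ.simplicial
      refine ⟨{S, S'}, ⟨by simp, ?_⟩, by ext; simp⟩
      rw [Finset.coe_pair]
      exact IsChain.pair hSS'
    have h2 : σ S ≤ σ S' ∨ σ S' ≤ σ S := by
      have := h1.2
      rw [Finset.coe_pair] at this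
      exact this.total (by simp) (by simp)
    rw [hτ S hS, hτ S' hS', hc.factorClass_le_iff, hc.factorClass_le_iff] at h2
    rcases h2 with h2 | h2
    · exact h2
    · have h3 : (τ S').1.card ≤ (τ S).1.card := Finset.card_le_card h2
      rw [hcard S hS, hcard S' hS'] at h3
      have : S = S' := Subtype.ext (Finset.eq_of_subset_of_card_le hSS' h3)
      rw [this]
  have hsing : ∀ i ∈ T, ∃ j, (τ (vertex hn i)).1 = {j} := fun i hi => by
    apply Finset.card_eq_one.1
    rw [hcard _ (by simpa [vertex] using hi)]
    simp [vertex]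
  have : Nonempty (Fin n) := ⟨⟨0, by omega⟩⟩
  choose! π hπ using hsing
  have hπinj : Set.InjOn π T := by
    intro i hi j hj hij
    have h1 : τ (vertex hn i) = τ (vertex hn j) := Subtype.ext (by
      rw [hπ i hi, hπ j hj, hij])
    have h2 : σ (vertex hn i) = σ (vertex hn j) := by
      rw [hτ _ (by simpa [vertex] using hi), hτ _ (by simpa [vertex] using hj), h1]
    have h3 := congrArg Subtype.val (hσ.injective h2)
    simpa [vertex] using h3
  -- The injection of indices is defined on `T` only; any extension to a permutation will do.
  obtain ⟨e, he⟩ := Finset.exists_equiv_extend_of_card_eq (α := Fin n) (t := Finset.univ)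
    (s := T) (f := π) (by simp) (by simp) hπinj
  set e' : Fin n ≃ Fin n := e.trans (Equiv.subtypeUnivEquiv (by simp))
  have he' : ∀ i ∈ T, e' i = π i := he
  refine ⟨c ∘ e', hc.comp_equiv e', fun S hS => ?_⟩
  rw [hτ S hS]
  -- By monotonicity `τ S` contains the images of the vertices of `S`, and it has the same
  -- cardinality.
  have himg : S.1.image π = (τ S).1 := by
    apply Finset.eq_of_subset_of_card_le
    · intro j hj
      obtain ⟨i, hi, rfl⟩ := Finset.mem_image.1 hj
      have h1 := hmono (vertex hn i) S (by simpa [vertex] using hS hi) hS (by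
        change {i} ⊆ S.1
        simpa using hi)
      apply h1
      rw [hπ i (hS hi)]
      simp
    · rw [hcard S hS, Finset.card_image_of_injOn (hπinj.mono (Finset.coe_subset.2 hS))]
  refine congrArg cls (Subtype.ext ?_)
  change Subgroup.closure _ = Subgroup.closure _
  rw [Set.image_comp, ← himg, Finset.coe_image]
  congr 2
  exact Set.image_congr fun i hi => (he' i (hS hi)).symm

theorem isStandard_apartment_iff (hn : 3 ≤ n) {σ : BdryVertex n → OF n} (hσ : IsApartmentMap σ) :
    IsStandard (apartment σ) ↔
      ∃ (c : Fin n → FreeGroup (Fin n)) (hc : IsBasis c), ∀ S, σ S = hc.factorClass S := by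
  have hstd : ∀ b : FreeGroupBasis (Fin n) (FreeGroup (Fin n)),
      standardAF b = fullSubcomplex (orderComplex (AF n))
        {A | ∃ S ∈ (Set.univ : Set (BdryVertex n)),
          A.1 = Subgroup.closure (b '' (S.1 : Set (Fin n)))} := fun b => by
    simp only [Set.mem_univ, true_and]; rfl
  constructor
  · rintro ⟨b, hb⟩
    rw [hstd, apartment, ← fullSubcomplex_univ (orderComplex (BdryVertex n))] at hb
    obtain ⟨d, hd, h⟩ := b.isBasis.exists_factorClass_eq hn hσ Finset.univ
      fun S _ => b.isBasis.exists_eq_factorClass hb (Set.mem_univ S)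
    exact ⟨d, hd, fun S => h S (Finset.subset_univ _)⟩
  · rintro ⟨c, hc, h⟩
    refine ⟨hc.toFreeGroupBasis, ?_⟩
    rw [hstd, apartment, ← fullSubcomplex_univ (orderComplex (BdryVertex n)),
      hc.coe_toFreeGroupBasis]
    exact hc.imageComplex_eq fun S _ => h S

theorem isStandardFace_of_eq_factorClass (hc : IsBasis c) {σ : BdryVertex n → OF n}
    (T : BdryVertex n) (h : ∀ S ≤ T, σ S = hc.factorClass S) :
    IsStandardFace T.1.card (face σ T) := by
  refine ⟨hc.toFreeGroupBasis, T, rfl, ?_⟩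
  have := hc.imageComplex_eq (X := {S | S ≤ T}) h
  rw [standardFaceAF, hc.coe_toFreeGroupBasis]
  exact this

theorem IsStandardFace.exists_eq_factorClass (hn : 3 ≤ n) {σ : BdryVertex n → OF n}
    (hσ : IsApartmentMap σ) {T : BdryVertex n} {k : ℕ} (h : IsStandardFace k (face σ T)) :
    ∃ (c : Fin n → FreeGroup (Fin n)) (hc : IsBasis c), ∀ S ≤ T, σ S = hc.factorClass S := by
  obtain ⟨b, T', -, hb⟩ := h
  exact b.isBasis.exists_factorClass_eq hn hσ T.1
    fun S hS => b.isBasis.exists_eq_factorClass (X := {S | S ≤ T}) (Y := {S | S ≤ T'}) hb hS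

end FreeFactors

/-! ### Antipodal vertices and the three conditions -/

namespace FreeFactors

variable {n : ℕ} {c d : Fin n → FreeGroup (Fin n)}

theorem coe_oppBarycentre (hn : 3 ≤ n) (i : Fin n) :
    ((oppBarycentre hn i).1 : Set (Fin n)) = {i}ᶜ := by
  simp [oppBarycentre]

theorem coe_vertex (hn : 3 ≤ n) (i : Fin n) : ((vertex hn i).1 : Set (Fin n)) = {i} := by
  simp [vertex]

theorem le_oppBarycentre_iff (hn : 3 ≤ n) {i : Fin n} {S : BdryVertex n} :
    S ≤ oppBarycentre hn i ↔ i ∉ S.1 := by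
  constructor
  · intro h hi
    simpa [oppBarycentre] using h hi
  · intro h j hj
    simp only [oppBarycentre, Finset.mem_compl, Finset.mem_singleton]
    rintro rfl
    exact h hj

theorem card_oppBarycentre (hn : 3 ≤ n) (i : Fin n) : (oppBarycentre hn i).1.card = n - 1 := by
  simp [oppBarycentre, Finset.card_compl]

theorem exists_ne_ne (hn : 3 ≤ n) (i j : Fin n) : ∃ k, k ≠ i ∧ k ≠ j := by
  by_contra! h
  have h1 : (Finset.univ : Finset (Fin n)) ⊆ {i, j} := fun k _ => by
    by_cases hk : k = i
    · simp [hk]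
    · simp [h k hk]
  have := (Finset.card_le_card h1).trans Finset.card_le_two
  simp at this
  omega

theorem IsBasis.val_factor_vertex (hc : IsBasis c) (hn : 3 ≤ n) (i : Fin n) :
    (hc.factor (vertex hn i)).1 = Subgroup.zpowers (c i) := by
  change gen c _ = _
  rw [coe_vertex, gen_singleton]

theorem IsBasis.val_factor_oppBarycentre (hc : IsBasis c) (hn : 3 ≤ n) (i : Fin n) :
    (hc.factor (oppBarycentre hn i)).1 = gen c {i}ᶜ := by
  change gen c _ = _
  rw [coe_oppBarycentre]

theorem IsBasis.antipodal (hc : IsBasis c) (hn : 3 ≤ n) (i : Fin n) :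
    Antipodal (hc.factorClass (oppBarycentre hn i)) (hc.factorClass (vertex hn i)) := by
  refine ⟨_, _, rfl, rfl, ?_⟩
  rw [hc.val_factor_oppBarycentre, hc.val_factor_vertex, ← gen_singleton]
  simpa using hc.isFreeProduct_gen {i}ᶜ

/-- A product of basis elements with indices in `T` can replace each of them. -/
theorem exists_mem_gen_eq_mul_of_mul {ι G : Type*} [Group G] (c : ι → G) (T : Finset ι) :
    ∃ u ∈ gen c (T : Set ι), ∀ j ∈ T, ∃ γ ∈ gen c {j}ᶜ, ∃ δ ∈ gen c {j}ᶜ, u = γ * c j * δ := by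
  classical
  induction T using Finset.induction_on with
  | empty => exact ⟨1, one_mem _, by simp⟩
  | insert a T ha ih =>
    obtain ⟨u, hu, h⟩ := ih
    refine ⟨c a * u, mul_mem (mem_gen (by simp)) (gen_mono (by simp) hu), fun j hj => ?_⟩
    rcases Finset.mem_insert.1 hj with rfl | hj
    · refine ⟨1, one_mem _, u, gen_mono ?_ hu, by group⟩
      intro l hl
      rintro rfl
      exact ha hl
    · obtain ⟨γ, hγ, δ, hδ, rfl⟩ := h j hj
      refine ⟨c a * γ, mul_mem (mem_gen ?_) hγ, δ, hδ, by group⟩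
      rintro rfl
      exact ha hj

theorem IsBasis.exists_adjacent_antipodal (hc : IsBasis c) (hn : 3 ≤ n) (i : Fin n) :
    ∃ u : OF n, HasRank u 1 ∧ Adjacent u (hc.factorClass (oppBarycentre hn i)) ∧
      ∀ j : Fin n, j ≠ i → Antipodal (hc.factorClass (oppBarycentre hn j)) u := by
  obtain ⟨u, hu, hrep⟩ := exists_mem_gen_eq_mul_of_mul c {i}ᶜ
  have hbas : ∀ j, j ≠ i → IsBasis (Function.update c j u) := fun j hj => by
    obtain ⟨γ, hγ, δ, hδ, h⟩ := hrep j (by simpa using hj)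
    rw [h]
    exact hc.update hγ hδ (Or.inl rfl)
  -- The index `k` is auxiliary: the basis with `u` in place of `c k` shows that `u` generates a
  -- free factor of rank one.
  obtain ⟨k, hk, -⟩ := exists_ne_ne hn i i
  have hA := (hbas k hk).val_factor_vertex hn k
  rw [Function.update_self] at hA
  have hrank : HasRank ((hbas k hk).factorClass (vertex hn k)) 1 :=
    (hbas k hk).hasRank_factorClass (vertex hn k)
  refine ⟨(hbas k hk).factorClass (vertex hn k), hrank, ⟨?_, Or.inl ?_⟩, ?_⟩
  · intro h
    rw [h] at hrank
    have := hc.eq_card_of_hasRank hrank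
    rw [card_oppBarycentre] at this
    omega
  · refine ⟨_, _, rfl, rfl, ?_⟩
    change ((hbas k hk).factor (vertex hn k)).1 ≤ (hc.factor (oppBarycentre hn i)).1
    rw [hA, hc.val_factor_oppBarycentre, Subgroup.zpowers_le]
    simpa using hu
  · intro j hj
    refine ⟨_, _, rfl, rfl, ?_⟩
    rw [hA, hc.val_factor_oppBarycentre]
    have h1 := (hbas j hj).isFreeProduct_gen {j}ᶜ
    rw [compl_compl, gen_singleton, Function.update_self] at h1
    have h2 : gen (Function.update c j u) {j}ᶜ = gen c {j}ᶜ :=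
      gen_congr fun l hl => Function.update_of_ne hl _ _
    rwa [h2] at h1

theorem eq_or_eq_inv_of_zpowers_eq {ι G : Type*} [Group G] {c : ι → G} (hc : IsBasis c) {i : ι}
    {x : G} (h : Subgroup.zpowers x = Subgroup.zpowers (c i)) : x = c i ∨ x = (c i)⁻¹ := by
  obtain ⟨k, hk⟩ := Subgroup.mem_zpowers_iff.1 (h ▸ Subgroup.mem_zpowers x)
  obtain ⟨l, hl⟩ := Subgroup.mem_zpowers_iff.1 (h.symm ▸ Subgroup.mem_zpowers (c i))
  have h1 : c i ^ (k * l) = c i ^ (1 : ℤ) := by rw [zpow_mul, hk, hl, zpow_one]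
  rcases Int.eq_one_or_neg_one_of_mul_eq_one (hc.zpow_injective i h1) with rfl | rfl
  · left; rw [← hk, zpow_one]
  · right; rw [← hk, zpow_neg_one]

/-- Conjugating the pair of representatives makes the first factor the given one, at the cost of a
conjugator on the cyclic factor. Of the free product only generation is retained, which is all that
the exchange lemma needs. -/
theorem exists_closure_eq_top_of_antipodal {i : Fin n} {s : FreeGroup (Fin n)} {A C : AF n}
    (hA : A.1 = gen c {i}ᶜ) (hC : C.1 = Subgroup.zpowers s) (h : Antipodal (cls A) (cls C)) :
    ∃ x, Subgroup.closure (insert (x * s * x⁻¹) (c '' {i}ᶜ)) = ⊤ := by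
  obtain ⟨A', C', hA', hC', hAC⟩ := h
  obtain ⟨g, hg⟩ := cls_eq_cls_iff.1 hA'.symm
  obtain ⟨k, hk⟩ := cls_eq_cls_iff.1 hC'.symm
  have h1 := (hAC.conjBy g⁻¹).sup_eq_top
  rw [hg, hk, hA, hC, conjBy_conjBy, conjBy_conjBy, inv_mul_cancel, conjBy_one, conjBy_zpowers,
    sup_comm, Subgroup.zpowers_eq_closure, ← Subgroup.closure_union] at h1
  exact ⟨g⁻¹ * k, h1⟩

theorem exists_eq_zpowers_of_basis {G : Type*} [Group G] {A : Subgroup G}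
    (e : FreeGroupBasis (Fin 1) A) : ∃ x, A = Subgroup.zpowers x := by
  refine ⟨e 0, ?_⟩
  have h := congrArg (Subgroup.map A.subtype) e.isBasis.gen_univ
  have h0 : (Set.univ : Set (Fin 1)) = {0} := by ext j; simp [Subsingleton.elim j 0]
  rw [h0, gen_singleton, MonoidHom.map_zpowers, ← MonoidHom.range_eq_map,
    Subgroup.range_subtype] at h
  exact h.symm

/-- Two distinct basis elements do not lie in a cyclic subgroup. -/
theorem IsBasis.not_mem_zpowers {ι G : Type*} [Group G] {c : ι → G} (hc : IsBasis c) {j k : ι}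
    (hjk : j ≠ k) {x : G} (hj : c j ∈ Subgroup.zpowers x) (hk : c k ∈ Subgroup.zpowers x) :
    False := by
  obtain ⟨p, hp⟩ := Subgroup.mem_zpowers_iff.1 hj
  obtain ⟨q, hq⟩ := Subgroup.mem_zpowers_iff.1 hk
  obtain ⟨m, hm⟩ := hc.exists_eq_zpow_of_commute (i := k) (x := c j) (by
    rw [← hp, ← hq, ← zpow_add, ← zpow_add, add_comm])
  have := congrArg (hc.expo j) hm
  rw [hc.expo_self, map_zpow, hc.expo_of_ne hjk.symm, one_zpow] at this
  simp at this

/-- If a rank-one vertex is adjacent to the class of a face, it is represented in the face. -/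
theorem IsBasis.exists_mem_of_adjacent (hc : IsBasis c) (hn : 3 ≤ n) {i : Fin n} {u : OF n}
    (hu : HasRank u 1) (h : Adjacent u (hc.factorClass (oppBarycentre hn i))) :
    ∃ (A : AF n) (x : FreeGroup (Fin n)) (g : FreeGroup (Fin n)), cls A = u ∧
      A.1 = Subgroup.zpowers x ∧ g * x * g⁻¹ ∈ gen c {i}ᶜ := by
  obtain ⟨A, rfl, ⟨e⟩⟩ := hu
  obtain ⟨x, hx⟩ := exists_eq_zpowers_of_basis e
  rcases h.2 with ⟨A', B, hA', hB, hAB⟩ | ⟨B, A', hB, hA', hBA⟩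
  · obtain ⟨g, hg⟩ := cls_eq_cls_iff.1 hA'.symm
    obtain ⟨k, hk⟩ := cls_eq_cls_iff.1 hB.symm
    refine ⟨A, x, k⁻¹ * g, rfl, hx, ?_⟩
    have h1 : g * x * g⁻¹ ∈ B.1 := by
      apply hAB
      rw [hg, hx, conjBy_zpowers]
      exact Subgroup.mem_zpowers _
    rw [hk, hc.val_factor_oppBarycentre, mem_conjBy] at h1
    rwa [show k⁻¹ * g * x * (k⁻¹ * g)⁻¹ = k⁻¹ * (g * x * g⁻¹) * k by group]
  -- The inclusion cannot go the other way: for `n ≥ 3` the face contains two distinct basis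
  -- elements, which do not lie in a common cyclic group.
  · exfalso
    obtain ⟨g, hg⟩ := cls_eq_cls_iff.1 hA'.symm
    obtain ⟨k, hk⟩ := cls_eq_cls_iff.1 hB.symm
    obtain ⟨j, hj, -⟩ := exists_ne_ne hn i i
    obtain ⟨l, hl, hlj⟩ := exists_ne_ne hn i j
    have h1 : ∀ m, m ≠ i → k * c m * k⁻¹ ∈ Subgroup.zpowers (g * x * g⁻¹) := fun m hm => by
      rw [← conjBy_zpowers, ← hx, ← hg]
      apply hBA
      rw [hk, hc.val_factor_oppBarycentre, conjBy_gen]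
      exact mem_gen (c := fun m => k * c m * k⁻¹) hm
    exact (hc.conj k).not_mem_zpowers hlj (h1 l hl) (h1 j hj)

/-- A basis can be changed, without changing the spans of its members of index other than `i`, so
that its members are conjugate to given elements. -/
theorem IsBasis.exists_isConj {ι G : Type*} [Group G] {c : ι → G} (hc : IsBasis c) {i : ι}
    {a : ι → G} (hconj : ∀ j ≠ i, ∃ g, conjBy g (Subgroup.zpowers (a j)) = Subgroup.zpowers (c j))
    (hi : ∃ x, Subgroup.closure (insert (x * a i * x⁻¹) (c '' {i}ᶜ)) = ⊤) :
    ∃ b : ι → G, IsBasis b ∧ (∀ j, IsConj (a j) (b j)) ∧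
      ∀ S : Set ι, i ∉ S → gen b S = gen c S := by
  classical
  choose! g hg using hconj
  obtain ⟨x, hx⟩ := hi
  have hinv : ∀ j ≠ i, g j * a j * (g j)⁻¹ = c j ∨ g j * a j * (g j)⁻¹ = (c j)⁻¹ := fun j hj =>
    eq_or_eq_inv_of_zpowers_eq hc ((conjBy_zpowers _ _).symm.trans (hg j hj))
  -- Generators of the same cyclic factor differ at most by inversion, so adjusting signs off `i`
  -- changes no span; then the member `i` is exchanged.
  set f : ι → G := fun j => if j = i then c i else g j * a j * (g j)⁻¹ with hf
  have hfi : ∀ j ≠ i, f j = g j * a j * (g j)⁻¹ := fun j hj => if_neg hj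
  have hfb : IsBasis f := hc.of_eq_or_eq_inv fun j => by
    by_cases hj : j = i
    · left; rw [hf]; simp [hj]
    · rw [hfi j hj]; exact hinv j hj
  have hgen : ∀ S : Set ι, i ∉ S → gen f S = gen c S := fun S hS =>
    gen_eq_of_eq_or_eq_inv fun j hj => by
      have hji : j ≠ i := by rintro rfl; exact hS hj
      rw [hfi j hji]; exact hinv j hji
  have htop : Subgroup.closure (insert (x * a i * x⁻¹) (f '' {i}ᶜ)) = ⊤ := by
    rw [Set.insert_eq, Subgroup.closure_union] at hx ⊢
    rw [← hx]
    congr 1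
    exact hgen _ (by simp)
  refine ⟨_, hfb.update_of_closure_eq_top htop, fun j => ?_, fun S hS => ?_⟩
  · by_cases hj : j = i
    · subst hj; rw [Function.update_self]; exact isConj_iff.2 ⟨x, rfl⟩
    · rw [Function.update_of_ne hj, hfi j hj]; exact isConj_iff.2 ⟨g j, rfl⟩
  · rw [← hgen S hS]
    refine gen_congr fun j hj => Function.update_of_ne ?_ _ _
    rintro rfl
    exact hS hj

/-- Condition (2) makes the face bases memberwise conjugate, condition (3) supplies the elements `u`
that allow merging, and the glued basis restricts on each face to a conjugate of the basis of that
face. -/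
theorem exists_basis_of_face_conditions (hn : 3 ≤ n) {σ : BdryVertex n → OF n}
    (hface : ∀ i, ∃ (c : Fin n → FreeGroup (Fin n)) (hc : IsBasis c),
      ∀ S ≤ oppBarycentre hn i, σ S = hc.factorClass S)
    (hanti : ∀ i : Fin n, Antipodal (σ (oppBarycentre hn i)) (σ (vertex hn i)))
    (hadj : ∀ i : Fin n, ∃ u : OF n, HasRank u 1 ∧ Adjacent u (σ (oppBarycentre hn i)) ∧
      ∀ j : Fin n, j ≠ i → Antipodal (σ (oppBarycentre hn j)) u) :
    ∃ (c : Fin n → FreeGroup (Fin n)) (hc : IsBasis c), ∀ S, σ S = hc.factorClass S := by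
  choose c hc hσ using hface
  choose k hk using fun i => (exists_ne_ne hn i i).imp fun _ h => h.1
  -- A fixed generator for each rank-one vertex, read off from some face containing it. It settles
  -- the choice between a generator and its inverse for all faces at once.
  set a : Fin n → FreeGroup (Fin n) := fun i => c (k i) i
  have hvert : ∀ i j, i ≠ j → vertex hn j ≤ oppBarycentre hn i := fun i j hij =>
    (le_oppBarycentre_iff hn).2 (by simpa [vertex] using hij)
  have hb : ∀ i, ∃ b : Fin n → FreeGroup (Fin n), IsBasis b ∧ (∀ j, IsConj (a j) (b j)) ∧
      ∀ S : Set (Fin n), i ∉ S → gen b S = gen (c i) S := fun i => by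
    apply (hc i).exists_isConj
    · intro j hj
      have h1 := (hσ (k j) _ (hvert _ _ (hk j))).symm.trans (hσ i _ (hvert _ _ hj.symm))
      obtain ⟨g, hg⟩ := cls_eq_cls_iff.1 h1
      rw [(hc _).val_factor_vertex, (hc _).val_factor_vertex] at hg
      exact ⟨g, hg.symm⟩
    · have h1 := hanti i
      rw [hσ i _ le_rfl, hσ (k i) _ (hvert _ _ (hk i))] at h1
      exact exists_closure_eq_top_of_antipodal ((hc i).val_factor_oppBarycentre hn i)
        ((hc _).val_factor_vertex hn i) h1
  choose b hb hab hgen using hb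
  have hσb : ∀ i, ∀ S ≤ oppBarycentre hn i, σ S = (hb i).factorClass S := fun i S hS => by
    rw [hσ i S hS]
    refine congrArg cls (Subtype.ext (hgen i _ ?_).symm)
    simpa using (le_oppBarycentre_iff hn).1 hS
  obtain ⟨d, hd, hdb⟩ := exists_glue (b := b) (by simpa using hn) hb
    (fun m k l => (hab m l).symm.trans (hab k l)) (by
      intro m k S hne hm hk
      let S' : BdryVertex n := ⟨S, hne, by rintro rfl; simp at hm⟩
      have h1 := (hσb m S' ((le_oppBarycentre_iff hn).2 hm)).symm.trans
        (hσb k S' ((le_oppBarycentre_iff hn).2 hk))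
      obtain ⟨g, hg⟩ := cls_eq_cls_iff.1 h1
      exact ⟨g, hg.symm⟩) (by
      intro m
      obtain ⟨u, hu1, hu2, hu3⟩ := hadj m
      rw [hσb m _ le_rfl] at hu2
      obtain ⟨A, x, g, rfl, hA, hx⟩ := (hb m).exists_mem_of_adjacent hn hu1 hu2
      refine ⟨_, hx, fun l hl => ?_⟩
      have h1 := hu3 l hl
      rw [hσb l _ le_rfl] at h1
      obtain ⟨y, hy⟩ := exists_closure_eq_top_of_antipodal
        ((hb l).val_factor_oppBarycentre hn l) hA h1
      refine ⟨y * g⁻¹, ?_⟩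
      rwa [show y * g⁻¹ * (g * x * g⁻¹) * (y * g⁻¹)⁻¹ = y * x * y⁻¹ by group])
  refine ⟨d, hd, fun S => ?_⟩
  obtain ⟨i, hi⟩ : ∃ i, i ∉ S.1 := by
    by_contra! h
    exact S.2.2 (Finset.eq_univ_iff_forall.2 h)
  rw [hσb i S ((le_oppBarycentre_iff hn).2 hi)]
  obtain ⟨g, hg⟩ := hdb i
  refine cls_eq_cls_iff.2 ⟨g, ?_⟩
  change gen d _ = conjBy g (gen (b i) _)
  rw [conjBy_gen]
  refine gen_congr fun j hj => hg j ?_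
  rintro rfl
  exact hi hj

end FreeFactors

theorem mainTheorem9 {n : ℕ} (hn : 3 ≤ n) (σ : BdryVertex n → OF n) (hσ : IsApartmentMap σ) :
    IsStandard (apartment σ) ↔
      (∀ T : BdryVertex n, T.1.card = n - 1 → IsStandardFace (n - 1) (face σ T)) ∧
      (∀ i : Fin n, Antipodal (σ (oppBarycentre hn i)) (σ (vertex hn i))) ∧
      (∀ i : Fin n, ∃ u : OF n, HasRank u 1 ∧ Adjacent u (σ (oppBarycentre hn i)) ∧
        ∀ j : Fin n, j ≠ i → Antipodal (σ (oppBarycentre hn j)) u) := by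
  rw [isStandard_apartment_iff hn hσ]
  constructor
  · rintro ⟨c, hc, h⟩
    simp only [h]
    exact ⟨fun T hT => hT ▸ isStandardFace_of_eq_factorClass hc T fun S _ => h S,
      hc.antipodal hn, hc.exists_adjacent_antipodal hn⟩
  · rintro ⟨h₁, h₂, h₃⟩
    exact exists_basis_of_face_conditions hn
      (fun i => (h₁ _ (card_oppBarycentre hn i)).exists_eq_factorClass hn hσ) h₂ h₃
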